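/- **Conventions.** For $1\le p<\infty$, $L^p(\mathbb R)$ is the usual real Lebesgue space with norm $\|\cdot\|_p$; for $p=\infty$ the symbol $L^\infty(\mathbb R)$ stands for the space $C(\mathbb R)$ of bounded uniformly continuous functions with the sup-norm. For $\alpha>0$ put $m=\lfloor\alpha\rfloor+1$; $Lip^*(\alpha,L^p)$ is the set of all $f\in L^p(\mathbb R)$ with $$\omega_m(f,\delta)_p:=\sup_{|t|\le\delta}\Big\|\sum_{j=0}^m\binom mj(-1)^{m-j}f(\cdot+jt)\Big\|_p=\mathcal O(\delta^\alpha),\qquad \delta\to0^+ .$$ A *discrete kernel* is a bounded $\varphi\in L^1(\mathbb R)$ with $\sum_{k\in\mathbb Z}\varphi(u-k)=1$ for every $u\in\mathbb R$; a *continuous kernel* is a function $\psi\in L^1(\mathbb R)$, bounded in a neighbourhood of $0$, with $\int_{\mathbb R}\psi=1$. For $w>0$, $$(\mathcal D_w^{\varphi,\psi}f)(x)=\sum_{k\in\mathbb Z}\varphi(wx-k)\,w\int_{\mathbb R}\psi(wu-k)f(u)\,du .$$ Write $M_0(\xi)=\sup_{u\in\mathbb R}\sum_{k\in\mathbb Z}|\xi(u-k)|$.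 A function $\xi$ satisfies $(\Theta)$ for $\theta$ if $\xi(u)=\mathcal O(|u|^{-\theta})$ as $|u|\to\infty$. $W^{r,1}(\mathbb R)$ is the set of $\varphi\in L^1(\mathbb R)$ such that $\varphi^{(r-1)}$ exists and is absolutely continuous and $\varphi^{(r)}\in L^1(\mathbb R)$. (The derivative $\varphi^{(r)}$ exists almost everywhere; it is set equal to $0$ where $\varphi^{(r-1)}$ is not differentiable.) **Theorem.** Let $r>1$ be an integer. Let $\varphi\in W^{r,1}(\mathbb R)$ be a discrete kernel such that (i) for each $\nu=1,\dots,r$ the series $m_\nu(\varphi,u)=\sum_{k\in\mathbb Z}\varphi(u-k)(k-u)^\nu$ converges absolutely for every $u\in\mathbb R$ and its sum does not depend on $u$. Let $\psi$ be a continuous kernel. Let $1\le p\le\infty$, $0<\alpha<r$, and let $f\in L^p(\mathbb R)$ satisfy $$\|\mathcal D_w^{\varphi,\psi}f-f\|_p=\mathcal O(w^{-\alpha}),\qquad w\to+\infty .$$ (a) If $p=\infty$, the functions $\varphi^{(i)}$, $i=1,\dots,r$, and $\psi$ satisfy $(\Theta)$ for some $\theta>r+1$, and $M_0(\varphi^{(r)})<\infty$,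 then $f\in Lip^*(\alpha,L^\infty)$. (b) If $1\le p<\infty$, the functions $\varphi^{(i)}$, $i=1,\dots,r$, and $\psi$ satisfy $(\Theta)$ for some $\theta>pr+1$, $M_0(\psi)<\infty$, $M_0(\varphi^{(r)})<\infty$ in case $p>1$, and $\psi$ has compact support in case $p=1$, then $f\in Lip^*(\alpha,L^p)$. -/

import Mathlib

open MeasureTheory Filter Topology
open scoped ENNReal

noncomputable section

namespace Durrmeyer

/-- The space `L^p(ℝ)`, with the convention that for `p = ∞` it stands for the space `C(ℝ)` of
bounded uniformly continuous functions. -/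
def MemSpace (p : ℝ≥0∞) (f : ℝ → ℝ) : Prop :=
  if p = ∞ then UniformContinuous f ∧ ∃ B : ℝ, ∀ x, |f x| ≤ B else MemLp f p volume

/-- The norm of `MemSpace p`: the `L^p` norm for `p < ∞` and the sup norm for `p = ∞`. -/
def pNorm (p : ℝ≥0∞) (f : ℝ → ℝ) : ℝ≥0∞ :=
  if p = ∞ then ⨆ x, ‖f x‖ₑ else eLpNorm f p volume

/-- The finite difference `Δ^m_t (f, x) = ∑_{j ≤ m} (m choose j) (-1)^(m-j) f (x + j t)`. -/
def diff (m : ℕ) (t : ℝ) (f : ℝ → ℝ) (x : ℝ) : ℝ :=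
  ∑ j ∈ Finset.range (m + 1), (m.choose j : ℝ) * (-1) ^ (m - j) * f (x + j * t)

/-- The modulus of smoothness `ω_m (f, δ)_p = sup_{|t| ≤ δ} ‖Δ^m_t (f, ·)‖_p`. -/
def modulus (m : ℕ) (f : ℝ → ℝ) (δ : ℝ) (p : ℝ≥0∞) : ℝ≥0∞ :=
  ⨆ t : ℝ, ⨆ _ : |t| ≤ δ, pNorm p (diff m t f)

/-- The generalized Lipschitz class `Lip*(α, L^p)`: functions of `L^p` whose modulus of smoothness
of order `⌊α⌋ + 1` is `O(δ^α)` as `δ → 0⁺`. -/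
def MemLipStar (α : ℝ) (p : ℝ≥0∞) (f : ℝ → ℝ) : Prop :=
  MemSpace p f ∧ ∃ N : ℝ, ∀ᶠ δ : ℝ in 𝓝[>] 0,
    modulus (⌊α⌋₊ + 1) f δ p ≤ ENNReal.ofReal (N * δ ^ α)

/-- The Sobolev space `W^{r,1}(ℝ)`, `r ≥ 1`: functions `φ ∈ L^1` such that `φ^{(r-1)}` exists and
is absolutely continuous, with `φ^{(r)} ∈ L^1`. Here `iteratedDeriv r φ` is the pointwise
derivative of `φ^{(r-1)}`, which exists almost everywhere and represents the distributional
derivative. -/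
structure MemSobolevOne (r : ℕ) (φ : ℝ → ℝ) : Prop where
  integrable : Integrable φ
  contDiff : ContDiff ℝ ((r - 1 : ℕ) : ℕ∞) φ
  absolutelyContinuous : ∀ a b : ℝ,
    AbsolutelyContinuousOnInterval (iteratedDeriv (r - 1) φ) a b
  integrable_iteratedDeriv : Integrable (iteratedDeriv r φ)

/-- The discrete algebraic moment `m_ν(φ, u) = ∑_{k ∈ ℤ} φ(u - k) (k - u)^ν` converges (absolutely)
to `m`. -/
def HasDiscreteMoment (φ : ℝ → ℝ) (ν : ℕ) (u m : ℝ) : Prop :=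
  HasSum (fun k : ℤ => φ (u - k) * ((k : ℝ) - u) ^ ν) m

/-- The discrete absolute moment `M_ν(ξ) = sup_u ∑_{k ∈ ℤ} |ξ(u - k)| |u - k|^ν`. -/
def absMoment (ν : ℕ) (ξ : ℝ → ℝ) : ℝ≥0∞ :=
  ⨆ u : ℝ, ∑' k : ℤ, ‖ξ (u - k)‖ₑ * ‖u - (k : ℝ)‖ₑ ^ ν

/-- A discrete kernel: a bounded integrable function with `m_0(φ, u) = 1` for all `u`. -/
structure IsDiscreteKernel (φ : ℝ → ℝ) : Prop where
  integrable : Integrable φ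
  bounded : ∃ B : ℝ, ∀ u, |φ u| ≤ B
  moment_zero : ∀ u, HasDiscreteMoment φ 0 u 1

/-- A continuous kernel: an integrable function, bounded near the origin, of integral `1`. -/
structure IsContinuousKernel (ψ : ℝ → ℝ) : Prop where
  integrable : Integrable ψ
  bounded : ∃ B : ℝ, ∀ᶠ u in 𝓝 (0 : ℝ), |ψ u| ≤ B
  integral_eq_one : ∫ u, ψ u = 1

/-- The algebraic moments of orders `1, …, r` do not depend on the point. -/
def ConstantMoments (r : ℕ) (φ : ℝ → ℝ) : Prop :=
  ∀ ν : ℕ, 1 ≤ ν → ν ≤ r → ∃ m : ℝ, ∀ u, HasDiscreteMoment φ ν u m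

/-- `ξ(u) = O(|u|^{-θ})` as `|u| → ∞`. -/
def Decay (θ : ℝ) (ξ : ℝ → ℝ) : Prop :=
  ξ =O[cocompact ℝ] fun u => |u| ^ (-θ)

/-- The Durrmeyer sampling operator
`(D_w f)(x) = ∑_{k ∈ ℤ} φ(w x - k) w ∫ ψ(w u - k) f(u) du`. -/
def op (φ ψ : ℝ → ℝ) (w : ℝ) (f : ℝ → ℝ) (x : ℝ) : ℝ :=
  ∑' k : ℤ, φ (w * x - k) * (w * ∫ u, ψ (w * u - k) * f u)

end Durrmeyer

end

/-! The proof is a Bernstein-type inverse argument run directly at the order `m = ⌊α⌋ + 1 ≤ r` of the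
modulus of smoothness in the definition of the class.

Write `D_w f` for the image of `f` under the operator. Two inequalities for its `m`-th derivative
carry the argument:
`‖(D_w f)^{(m)}‖_p ≤ C w^m ‖f‖_p` and `‖(D_w g)^{(m)}‖_p ≤ C ‖g^{(m)}‖_p`. Applied to
`f = (f - D_v f) + D_v f`, they give
`‖(D_w f)^{(m)}‖_p ≤ C w^m v^{-α} + C ‖(D_v f)^{(m)}‖_p`,
and iteration along a geometric sequence with large ratio yields `‖(D_w f)^{(m)}‖_p = O(w^{m - α})`
along that sequence (`exists_forall_le_rpow_of_recursion`). Splitting a difference of `f` into those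
of `f - D_w f` and of `D_w f` with `w` comparable to `1 / δ` then bounds the modulus by `O(δ^α)`
(`KernelPair.inverse`).

By scaling, both inequalities reduce to `w = 1`, where
`(D_1 f)^{(m)}(x) = ∑ₖ φ^{(m)}(x - k) ∫ ψ(u - k) f(u) du`. Each follows from the Schur test
(`eLpNorm_le_of_periodized_kernel`) for a kernel invariant under diagonal integer translations. For
the first (`KernelPair.exists_eLpNorm_synth_le`) the kernel is `∑ₖ |φ^{(m)}(x - k)| |ψ(u - k)|`. For
the second (`KernelPair.exists_eLpNorm_synth_le_derivative`), constancy of the moments means that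
the discrete kernel maps polynomial sequences of degree below `m` to polynomials of degree below
`m`. Hence `∑ₖ φ^{(m)}(x - k) q(k) = 0` almost everywhere for such a polynomial `q`, and `g` may be
replaced by its Taylor remainder at `x`.

Derivatives are handled through chains of indefinite integrals (`PrimitiveChain`), which include the
locally absolutely continuous case. All estimates use the Lebesgue seminorm `eLpNorm`; for `p = ∞`
the sup norm is recovered at the end from continuity of `f`. -/

namespace Durrmeyer

/-! ### Integral operators with nonnegative kernels -/

theorem one_le_toReal {p : ℝ≥0∞} (hp : 1 ≤ p) (hp' : p ≠ ∞) : 1 ≤ p.toReal := by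
  rw [← ENNReal.toReal_one]
  exact (ENNReal.toReal_le_toReal ENNReal.one_ne_top hp').2 hp

/-- The Schur test. The exponents are arranged so that for `p = 1` only the column bound `B`, and
for `p = ∞` only the row bound `A`, has to be finite. -/
theorem eLpNorm_le_of_kernel {p : ℝ≥0∞} (hp : 1 ≤ p) {K : ℝ → ℝ → ℝ≥0∞}
    (hK : Measurable (Function.uncurry K)) {F h : ℝ → ℝ} (hh : AEStronglyMeasurable h volume)
    (hF : ∀ᵐ x, ‖F x‖ₑ ≤ ∫⁻ s, K x s * ‖h s‖ₑ) {A B : ℝ≥0∞}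
    (hA : ∀ᵐ x, ∫⁻ s, K x s ≤ A) (hB : ∀ᵐ s, ∫⁻ x, K x s ≤ B) :
    eLpNorm F p volume
      ≤ A ^ (1 - 1 / p.toReal) * B ^ (1 / p.toReal) * eLpNorm h p volume := by
  have hKx : ∀ x, Measurable (K x) := fun x => hK.of_uncurry_left
  rcases eq_or_ne p ∞ with rfl | hp'
  · simp only [ENNReal.toReal_top, div_zero, sub_zero, ENNReal.rpow_one, ENNReal.rpow_zero, mul_one,
      eLpNorm_exponent_top]
    refine essSup_le_of_ae_le _ ?_
    filter_upwards [hF, hA] with x hx hAx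
    calc ‖F x‖ₑ ≤ ∫⁻ s, K x s * ‖h s‖ₑ := hx
      _ ≤ ∫⁻ s, K x s * eLpNormEssSup h volume := by
        apply lintegral_mono_ae
        filter_upwards [ae_le_eLpNormEssSup (f := h) (μ := volume)] with s hs
        gcongr
      _ = (∫⁻ s, K x s) * eLpNormEssSup h volume := lintegral_mul_const _ (hKx x)
      _ ≤ A * eLpNormEssSup h volume := by gcongr
  · set q := p.toReal with hq
    have hq1 : 1 ≤ q := one_le_toReal hp hp'
    have hq0 : 0 < q := by linarith
    have hinv : 1 / q ≤ 1 := by rw [div_le_one hq0]; exact hq1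
    have hp0 : p ≠ 0 := (zero_lt_one.trans_le hp).ne'
    have hH : AEMeasurable (fun s => ‖h s‖ₑ) volume := hh.enorm
    rw [eLpNorm_eq_lintegral_rpow_enorm_toReal hp0 hp', eLpNorm_eq_lintegral_rpow_enorm_toReal hp0 hp',
      ← hq]
    have key : ∀ᵐ x, ‖F x‖ₑ ^ q ≤ A ^ (q - 1) * ∫⁻ s, K x s * ‖h s‖ₑ ^ q := by
      filter_upwards [hF, hA] with x hx hAx
      -- Hölder, after writing `K |h| = K ^ (1 - 1 / q) (K |h| ^ q) ^ (1 / q)`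
      have h1 : ∫⁻ s, K x s * ‖h s‖ₑ
          ≤ (∫⁻ s, K x s) ^ (1 - 1 / q) * (∫⁻ s, K x s * ‖h s‖ₑ ^ q) ^ (1 / q) := by
        refine le_trans (le_of_eq ?_) (ENNReal.lintegral_mul_norm_pow_le (hKx x).aemeasurable
          ((hKx x).aemeasurable.mul (hH.pow_const q)) (by linarith) (by positivity) (by ring))
        congr 1
        ext s
        rw [Pi.mul_apply, ENNReal.mul_rpow_of_nonneg _ _ (by positivity), ← mul_assoc,
          ← ENNReal.rpow_add_of_nonneg _ _ (by linarith) (by positivity), ← ENNReal.rpow_mul]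
        have : q * (1 / q) = 1 := by field_simp
        rw [this, ENNReal.rpow_one, sub_add_cancel, ENNReal.rpow_one]
      calc ‖F x‖ₑ ^ q ≤ ((∫⁻ s, K x s) ^ (1 - 1 / q)
            * (∫⁻ s, K x s * ‖h s‖ₑ ^ q) ^ (1 / q)) ^ q := by
              gcongr; exact hx.trans h1
        _ = (∫⁻ s, K x s) ^ (q - 1) * ∫⁻ s, K x s * ‖h s‖ₑ ^ q := by
          rw [ENNReal.mul_rpow_of_nonneg _ _ hq0.le, ← ENNReal.rpow_mul, ← ENNReal.rpow_mul]
          have e1 : 1 / q * q = 1 := by field_simp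
          have e2 : (1 - 1 / q) * q = q - 1 := by field_simp
          rw [e1, e2, ENNReal.rpow_one]
        _ ≤ _ := by gcongr
    have hKh : AEMeasurable (Function.uncurry fun x s => K x s * ‖h s‖ₑ ^ q)
        (volume.prod volume) :=
      hK.aemeasurable.mul ((hH.pow_const q).comp_snd)
    have main : ∫⁻ x, ‖F x‖ₑ ^ q ≤ A ^ (q - 1) * (B * ∫⁻ s, ‖h s‖ₑ ^ q) := by
      calc ∫⁻ x, ‖F x‖ₑ ^ q ≤ ∫⁻ x, A ^ (q - 1) * ∫⁻ s, K x s * ‖h s‖ₑ ^ q := lintegral_mono_ae key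
        _ = A ^ (q - 1) * ∫⁻ x, ∫⁻ s, K x s * ‖h s‖ₑ ^ q :=
          lintegral_const_mul'' _ hKh.lintegral_prod_right'
        _ = A ^ (q - 1) * ∫⁻ s, ∫⁻ x, K x s * ‖h s‖ₑ ^ q := by rw [lintegral_lintegral_swap hKh]
        _ ≤ A ^ (q - 1) * ∫⁻ s, B * ‖h s‖ₑ ^ q := by
          gcongr 1
          apply lintegral_mono_ae
          filter_upwards [hB] with s hs
          rw [lintegral_mul_const _ hK.of_uncurry_right]
          gcongr
        _ = _ := by rw [lintegral_const_mul'' _ (hH.pow_const q)]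
    calc (∫⁻ x, ‖F x‖ₑ ^ q) ^ (1 / q)
        ≤ (A ^ (q - 1) * (B * ∫⁻ s, ‖h s‖ₑ ^ q)) ^ (1 / q) := by gcongr
      _ = _ := by
        rw [ENNReal.mul_rpow_of_nonneg _ _ (by positivity),
          ENNReal.mul_rpow_of_nonneg _ _ (by positivity), ← ENNReal.rpow_mul, mul_assoc]
        have e2 : (q - 1) * (1 / q) = 1 - 1 / q := by field_simp
        rw [e2]

/-- The Schur test for a kernel periodized along the diagonal. -/
theorem eLpNorm_le_of_periodized_kernel {p : ℝ≥0∞} (hp : 1 ≤ p) {L : ℝ → ℝ → ℝ≥0∞}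
    (hL : Measurable (Function.uncurry L)) {F h : ℝ → ℝ} (hh : AEStronglyMeasurable h volume)
    (hF : ∀ᵐ x, ‖F x‖ₑ ≤ ∑' k : ℤ, ∫⁻ s, L (x - k) (s - k) * ‖h s‖ₑ) {A B : ℝ≥0∞}
    (hA : ∀ x, ∑' k : ℤ, ∫⁻ s, L (x - k) s ≤ A)
    (hB : ∀ᵐ s, ∑' k : ℤ, ∫⁻ x, L x (s - k) ≤ B) :
    eLpNorm F p volume
      ≤ A ^ (1 - 1 / p.toReal) * B ^ (1 / p.toReal) * eLpNorm h p volume := by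
  have hm : ∀ k : ℤ, Measurable (fun z : ℝ × ℝ => L (z.1 - k) (z.2 - k)) := fun k =>
    hL.comp (by fun_prop : Measurable fun z : ℝ × ℝ => (z.1 - (k : ℝ), z.2 - (k : ℝ)))
  have hmx : ∀ x (k : ℤ), Measurable (fun s => L (x - k) (s - k)) := fun x k =>
    (hm k).comp (by fun_prop : Measurable fun s : ℝ => (x, s))
  have hms : ∀ s (k : ℤ), Measurable (fun x => L (x - k) (s - k)) := fun s k =>
    (hm k).comp (by fun_prop : Measurable fun x : ℝ => (x, s))
  refine eLpNorm_le_of_kernel hp (K := fun x s => ∑' k : ℤ, L (x - k) (s - k))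
    (Measurable.tsum hm) hh ?_ ?_ ?_
  · filter_upwards [hF] with x hx
    refine hx.trans (le_of_eq ?_)
    simp_rw [← ENNReal.tsum_mul_right]
    exact (lintegral_tsum fun k => (hmx x k).aemeasurable.mul hh.enorm).symm
  · filter_upwards with x
    rw [lintegral_tsum fun k => (hmx x k).aemeasurable]
    refine le_trans (le_of_eq ?_) (hA x)
    congr 1
    ext k
    exact lintegral_sub_right_eq_self (fun s => L (x - k) s) (k : ℝ)
  · filter_upwards [hB] with s hs
    rw [lintegral_tsum fun k => (hms s k).aemeasurable]
    refine le_trans (le_of_eq ?_) hs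
    congr 1
    ext k
    exact lintegral_sub_right_eq_self (fun x => L x (s - k)) (k : ℝ)

/-- An interval of length `ℓ` meets every coset of `ℤ` in at most `ℓ + 1` points. -/
theorem tsum_indicator_uIoc_le (a b s : ℝ) :
    ∑' k : ℤ, (Set.uIoc a b).indicator (1 : ℝ → ℝ≥0∞) (s - k) ≤ ‖b - a‖ₑ + 1 := by
  have hmem : ∀ k : ℤ, s - k ∈ Set.uIoc a b ↔
      k ∈ Finset.Ico ⌈s - max a b⌉ ⌈s - min a b⌉ := by
    intro k
    rw [Finset.mem_Ico, Int.ceil_le, Int.lt_ceil, Set.uIoc, Set.mem_Ioc]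
    constructor <;> rintro ⟨h1, h2⟩ <;> constructor <;> linarith
  have hle : min a b ≤ max a b := min_le_max
  rw [tsum_eq_sum (s := Finset.Ico ⌈s - max a b⌉ ⌈s - min a b⌉)]
  · calc _ ≤ ∑ k ∈ Finset.Ico ⌈s - max a b⌉ ⌈s - min a b⌉, (1 : ℝ≥0∞) := by
          apply Finset.sum_le_sum
          intro k _
          exact Set.indicator_le_self _ _ _
      _ = ENNReal.ofReal ((⌈s - min a b⌉ - ⌈s - max a b⌉ : ℤ)) := by
          rw [Finset.sum_const, Int.card_Ico, nsmul_one, ← ENNReal.ofReal_natCast]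
          congr 1
          have : (0 : ℤ) ≤ ⌈s - min a b⌉ - ⌈s - max a b⌉ := by
            have : ⌈s - max a b⌉ ≤ ⌈s - min a b⌉ := Int.ceil_mono (by linarith)
            omega
          exact_mod_cast Int.toNat_of_nonneg this
      _ ≤ ENNReal.ofReal (|b - a| + 1) := by
          apply ENNReal.ofReal_le_ofReal
          push_cast
          have h1 := Int.ceil_lt_add_one (s - min a b)
          have h2 := Int.le_ceil (s - max a b)
          have h3 : max a b - min a b = |b - a| := by
            rw [max_sub_min_eq_abs']; exact abs_sub_comm a b
          linarith
      _ = _ := by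
          rw [ENNReal.ofReal_add (abs_nonneg _) zero_le_one, ENNReal.ofReal_one,
            ← Real.norm_eq_abs, ofReal_norm]
  · intro k hk
    rw [← hmem] at hk
    simp [hk]

/-! ### Scaling -/

/-- The factor is `w ^ (-1 / p)`; only its being the same for every function is used. -/
theorem exists_eLpNorm_comp_mul (p : ℝ≥0∞) {w : ℝ} (hw : 0 < w) :
    ∃ s : ℝ≥0∞, ∃ s' : ℝ≥0∞, s * s' = 1 ∧
      (∀ g : ℝ → ℝ, eLpNorm (fun x => g (w * x)) p volume = s * eLpNorm g p volume) ∧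
      ∀ g : ℝ → ℝ, eLpNorm (fun x => g (x / w)) p volume = s' * eLpNorm g p volume := by
  have key : ∀ v : ℝ, 0 < v → ∀ g : ℝ → ℝ, eLpNorm (fun x => g (v * x)) p volume
      = (ENNReal.ofReal v⁻¹) ^ (1 / p).toReal * eLpNorm g p volume := by
    intro v hv g
    have h1 := (Homeomorph.mulLeft₀ v hv.ne').measurableEmbedding.eLpNorm_map_measure
      (μ := volume) (p := p) (g := g)
    have h2 : Measure.map (Homeomorph.mulLeft₀ v hv.ne') volume
        = ENNReal.ofReal |v⁻¹| • (volume : Measure ℝ) := Real.map_volume_mul_left hv.ne'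
    rw [h2, eLpNorm_smul_measure_of_ne_zero (by simpa using hv.ne'), smul_eq_mul, abs_of_pos (by positivity)] at h1
    exact h1.symm
  refine ⟨_, (ENNReal.ofReal (w⁻¹)⁻¹) ^ (1 / p).toReal, ?_, key w hw, fun g => ?_⟩
  · rw [← ENNReal.mul_rpow_of_nonneg _ _ ENNReal.toReal_nonneg, ← ENNReal.ofReal_mul (by positivity)]
    simp [hw.ne']
  · simpa [div_eq_inv_mul] using key w⁻¹ (by positivity) g

/-! ### Chains of primitives -/

/-- `G 0, …, G m` is a chain of primitives: each `G i` with `i < m` is an indefinite integral of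
`G (i + 1)`. Equivalently, `G 0` has derivatives `G i` of orders `i < m`, the last of them is
locally absolutely continuous, and `G m` is a version of its almost everywhere derivative. -/
def PrimitiveChain (m : ℕ) (G : ℕ → ℝ → ℝ) : Prop :=
  ∀ i < m, ∀ a b : ℝ, IntervalIntegrable (G (i + 1)) volume a b ∧
    G i b - G i a = ∫ x in a..b, G (i + 1) x

namespace PrimitiveChain

variable {m : ℕ} {G : ℕ → ℝ → ℝ}

theorem mono {m' : ℕ} (hG : PrimitiveChain m G) (h : m' ≤ m) : PrimitiveChain m' G :=
  fun i hi => hG i (hi.trans_le h)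

theorem tail (hG : PrimitiveChain (m + 1) G) : PrimitiveChain m (fun i => G (i + 1)) :=
  fun i hi => hG (i + 1) (by omega)

theorem locallyIntegrable (hG : PrimitiveChain m G) {i : ℕ} (hi : i < m) :
    LocallyIntegrable (G (i + 1)) volume := by
  rw [locallyIntegrable_iff]
  intro K hK
  obtain ⟨R, hR⟩ := hK.isBounded.subset_closedBall 0
  rw [Real.closedBall_eq_Icc] at hR
  refine IntegrableOn.mono_set ?_ hR
  rw [integrableOn_Icc_iff_integrableOn_Ioc]
  exact (hG i hi _ _).1.1

theorem eq_add_integral (hG : PrimitiveChain m G) {i : ℕ} (hi : i < m) (a b : ℝ) :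
    G i b = G i a + ∫ x in a..b, G (i + 1) x := by
  linarith [(hG i hi a b).2]

theorem continuous (hG : PrimitiveChain m G) {i : ℕ} (hi : i < m) : Continuous (G i) := by
  have : G i = fun x => G i 0 + ∫ y in (0 : ℝ)..x, G (i + 1) y := by
    ext x
    exact hG.eq_add_integral hi 0 x
  rw [this]
  exact continuous_const.add
    (intervalIntegral.continuous_primitive (fun a b => (hG i hi a b).1) 0)

theorem comp_mul (hG : PrimitiveChain m G) {w : ℝ} (hw : w ≠ 0) :
    PrimitiveChain m (fun i x => w ^ i * G i (w * x)) := by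
  intro i hi a b
  obtain ⟨h1, h2⟩ := hG i hi (w * a) (w * b)
  refine ⟨IntervalIntegrable.const_mul ?_ _, ?_⟩
  · have := h1.comp_mul_left (c := w)
    simpa [hw] using this
  · rw [intervalIntegral.integral_const_mul, intervalIntegral.integral_comp_mul_left _ hw,
      ← mul_sub, h2, smul_eq_mul]
    field_simp
    ring

/-- A polynomial of degree less than `m` has vanishing `m`-th derivative. -/
theorem ae_eq_zero_of_polynomial (hG : PrimitiveChain m G) {Q : Polynomial ℝ}
    (hdeg : Q.degree < m) (hQ : G 0 =ᵐ[volume] fun x => Q.eval x) : G m =ᵐ[volume] 0 := by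
  induction m generalizing G Q with
  | zero =>
    have : Q = 0 := by simpa using hdeg
    filter_upwards [hQ] with x hx
    simpa [this] using hx
  | succ m ih =>
    have hQ' : G 0 = fun x => Q.eval x :=
      (Continuous.ae_eq_iff_eq volume (hG.continuous (Nat.succ_pos m)) Q.continuous).1 hQ
    refine ih hG.tail (Q := Polynomial.derivative Q) ?_ ?_
    · rw [Polynomial.degree_lt_iff_coeff_zero] at hdeg ⊢
      intro k hk
      rw [Polynomial.coeff_derivative, hdeg (k + 1) (by omega), zero_mul]
    · filter_upwards [LocallyIntegrable.ae_hasDerivAt_integral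
        (hG.locallyIntegrable (Nat.succ_pos m))] with x hx
      have h1 : HasDerivAt (G 0) (G 1 x) x := by
        have : G 0 = fun x => G 0 0 + ∫ y in (0 : ℝ)..x, G 1 y := by
          ext x
          exact hG.eq_add_integral (Nat.succ_pos m) 0 x
        rw [this]
        exact (hx 0).const_add _
      rw [hQ'] at h1
      exact h1.unique (Q.hasDerivAt x)

/-- Taylor's formula with a bound for the integral remainder. -/
theorem abs_sub_taylor_le (hG : PrimitiveChain (m + 1) G) (x u : ℝ) :
    |G 0 u - ∑ i ∈ Finset.range (m + 1), G i x * ((u - x) ^ i / i.factorial)|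
      ≤ |u - x| ^ m * ∫ s in Set.uIoc x u, |G (m + 1) s| := by
  induction m generalizing G u with
  | zero =>
    have h := (hG 0 one_pos x u).2
    simpa [h] using intervalIntegral.norm_integral_le_integral_norm_uIoc (f := G 1) (a := x) (b := u)
      (μ := volume)
  | succ m ih =>
    have h0 := hG 0 (Nat.succ_pos _) x u
    have hpow : ∀ i : ℕ, ∫ v in x..u, (v - x) ^ i / (i.factorial : ℝ)
        = (u - x) ^ (i + 1) / ((i + 1).factorial : ℝ) := by
      intro i
      rw [intervalIntegral.integral_div,
        intervalIntegral.integral_comp_sub_right (fun v => v ^ i) x, integral_pow,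
        Nat.factorial_succ]
      push_cast
      field_simp
      simp
    have hint : ∀ i ∈ Finset.range (m + 1), IntervalIntegrable
        (fun v => G (i + 1) x * ((v - x) ^ i / (i.factorial : ℝ))) volume x u := fun i _ =>
      (Continuous.intervalIntegrable (by fun_prop) _ _)
    -- the remainder of `G 0` is the integral of the remainder of `G 1`
    have hrem : G 0 u - ∑ i ∈ Finset.range (m + 1 + 1), G i x * ((u - x) ^ i / i.factorial)
        = ∫ v in x..u, (G 1 v
          - ∑ i ∈ Finset.range (m + 1), G (i + 1) x * ((v - x) ^ i / i.factorial)) := by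
      rw [intervalIntegral.integral_sub h0.1 (by
          simpa only [Finset.sum_fn] using IntervalIntegrable.sum _ hint),
        intervalIntegral.integral_finsetSum hint,
        Finset.sum_range_succ', ← h0.2]
      simp_rw [intervalIntegral.integral_const_mul, hpow]
      simp
      ring
    have hI : IntegrableOn (fun s => |G (m + 1 + 1) s|) (Set.uIoc x u) :=
      ((hG (m + 1) (Nat.lt_succ_self _) x u).1.def').norm
    rw [hrem, ← Real.norm_eq_abs]
    refine (intervalIntegral.norm_integral_le_of_norm_le_const
      (C := |u - x| ^ m * ∫ s in Set.uIoc x u, |G (m + 1 + 1) s|) ?_).trans (le_of_eq ?_)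
    · intro v hv
      have hv' : v ∈ Set.uIcc x u := Set.uIoc_subset_uIcc hv
      refine (ih hG.tail v).trans ?_
      refine mul_le_mul (pow_le_pow_left₀ (abs_nonneg _) (Set.abs_sub_left_of_mem_uIcc hv') m) ?_
        (integral_nonneg fun s => abs_nonneg (G (m + 1 + 1) s)) (by positivity)
      · exact setIntegral_mono_set hI (ae_of_all _ fun s => abs_nonneg _)
          (LE.le.eventuallyLE (Set.uIoc_subset_uIoc_of_uIcc_subset_uIcc
            (Set.uIcc_subset_uIcc_left hv')))
    · ring

end PrimitiveChain

/-! ### Finite differences -/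

theorem diff_zero (t : ℝ) (f : ℝ → ℝ) : diff 0 t f = f := by
  ext x
  simp [diff]

theorem diff_succ (m : ℕ) (t : ℝ) (f : ℝ → ℝ) :
    diff (m + 1) t f = diff m t (fun x => f (x + t) - f x) := by
  -- both sides are iterated forward differences
  have key : ∀ (n : ℕ) (g : ℝ → ℝ), diff n t g = (fwdDiff t)^[n] g := by
    intro n g
    ext x
    rw [fwdDiff_iter_eq_sum_shift, diff]
    refine Finset.sum_congr rfl fun j _ => ?_
    rw [zsmul_eq_mul, nsmul_eq_mul]
    push_cast
    ring
  rw [key, key, Function.iterate_succ_apply]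
  rfl

theorem eLpNorm_translate (p : ℝ≥0∞) {f : ℝ → ℝ} (hf : AEStronglyMeasurable f volume) (t : ℝ) :
    eLpNorm (fun x => f (x + t)) p volume = eLpNorm f p volume :=
  eLpNorm_comp_measurePreserving hf (measurePreserving_add_right volume t)

theorem aestronglyMeasurable_translate {f : ℝ → ℝ} (hf : AEStronglyMeasurable f volume) (t : ℝ) :
    AEStronglyMeasurable (fun x => f (x + t)) volume :=
  hf.comp_measurePreserving (measurePreserving_add_right volume t)

theorem eLpNorm_diff_le {p : ℝ≥0∞} (hp : 1 ≤ p) (m : ℕ) (t : ℝ) {f : ℝ → ℝ}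
    (hf : AEStronglyMeasurable f volume) :
    eLpNorm (diff m t f) p volume ≤ 2 ^ m * eLpNorm f p volume := by
  induction m generalizing f with
  | zero => simp [diff_zero]
  | succ m ih =>
    rw [diff_succ]
    refine (ih ((aestronglyMeasurable_translate hf t).sub hf)).trans ?_
    rw [pow_succ, mul_assoc]
    gcongr
    refine (eLpNorm_sub_le (aestronglyMeasurable_translate hf t) hf hp).trans (le_of_eq ?_)
    rw [eLpNorm_translate p hf, two_mul]

theorem measurable_indicator_uIoc {β : Type*} [MeasurableSpace β] {a b c : β → ℝ}
    (ha : Measurable a) (hb : Measurable b) (hc : Measurable c) :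
    Measurable fun z => (Set.uIoc (a z) (b z)).indicator (1 : ℝ → ℝ≥0∞) (c z) := by
  have hs : MeasurableSet {z | c z ∈ Set.uIoc (a z) (b z)} :=
    (measurableSet_lt (ha.min hb) hc).inter (measurableSet_le hc (ha.max hb))
  exact (measurable_const (a := (1 : ℝ≥0∞))).indicator hs

/-- A first difference is a moving integral of the derivative, so the Schur test applies. -/
theorem PrimitiveChain.eLpNorm_sub_le {p : ℝ≥0∞} (hp : 1 ≤ p) {m : ℕ} {G : ℕ → ℝ → ℝ}
    (hG : PrimitiveChain m G) {i : ℕ} (hi : i < m) (t : ℝ) :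
    eLpNorm (fun x => G i (x + t) - G i x) p volume ≤ ‖t‖ₑ * eLpNorm (G (i + 1)) p volume := by
  have hm := (hG.locallyIntegrable hi).aestronglyMeasurable
  have key := eLpNorm_le_of_kernel hp (F := fun x => G i (x + t) - G i x) (h := G (i + 1))
    (K := fun x s => (Set.uIoc x (x + t)).indicator (1 : ℝ → ℝ≥0∞) s) (A := ‖t‖ₑ) (B := ‖t‖ₑ)
    (measurable_indicator_uIoc (by fun_prop) (by fun_prop) (by fun_prop)) hm ?_ ?_ ?_
  · refine key.trans (le_of_eq ?_)
    have hinv : 1 / p.toReal ≤ 1 := by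
      rcases eq_or_ne p ∞ with rfl | hp'
      · simp
      · have := one_le_toReal hp hp'
        rw [div_le_one (by linarith)]; exact this
    rw [← ENNReal.rpow_add_of_nonneg _ _ (by linarith) (by positivity), sub_add_cancel,
      ENNReal.rpow_one]
  · filter_upwards with x
    rw [(hG i hi x (x + t)).2, intervalIntegral.intervalIntegral_eq_integral_uIoc]
    have h2 : ‖(if x ≤ x + t then (1 : ℝ) else -1) • ∫ s in Set.uIoc x (x + t), G (i + 1) s‖ₑ
        = ‖∫ s in Set.uIoc x (x + t), G (i + 1) s‖ₑ := by
      split_ifs <;> simp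
    rw [h2]
    refine (enorm_integral_le_lintegral_enorm _).trans (le_of_eq ?_)
    rw [← lintegral_indicator measurableSet_uIoc]
    congr 1
    ext s
    by_cases hs : s ∈ Set.uIoc x (x + t) <;> simp [hs]
  · filter_upwards with x
    rw [lintegral_indicator_one measurableSet_uIoc, Real.volume_uIoc, add_sub_cancel_left,
      ← Real.norm_eq_abs, ofReal_norm]
  · filter_upwards with s
    calc ∫⁻ x, (Set.uIoc x (x + t)).indicator (1 : ℝ → ℝ≥0∞) s
        ≤ ∫⁻ x, (Set.uIcc s (s - t)).indicator (1 : ℝ → ℝ≥0∞) x := by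
          apply lintegral_mono
          intro x
          by_cases hs : s ∈ Set.uIoc x (x + t)
          · have : x ∈ Set.uIcc s (s - t) := by
              rw [Set.mem_uIoc] at hs
              rw [Set.mem_uIcc]
              rcases hs with hs | hs
              · right; constructor <;> linarith
              · left; constructor <;> linarith
            simp [hs, this]
          · simp [hs]
      _ = ‖t‖ₑ := by
        rw [lintegral_indicator_one measurableSet_uIcc, Real.volume_interval, sub_sub_cancel_left,
          ← Real.norm_eq_abs, ofReal_norm, enorm_neg]

theorem PrimitiveChain.eLpNorm_diff_le {p : ℝ≥0∞} (hp : 1 ≤ p) {m : ℕ} {G : ℕ → ℝ → ℝ}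
    (hG : PrimitiveChain m G) (t : ℝ) :
    eLpNorm (diff m t (G 0)) p volume ≤ ‖t‖ₑ ^ m * eLpNorm (G m) p volume := by
  induction m generalizing G with
  | zero => simp [diff_zero]
  | succ m ih =>
    have hG' : PrimitiveChain m (fun i x => G i (x + t) - G i x) := by
      intro i hi a b
      obtain ⟨h1, h2⟩ := hG i (by omega) a b
      obtain ⟨h3, h4⟩ := hG i (by omega) (a + t) (b + t)
      have h5 : IntervalIntegrable (fun x => G (i + 1) (x + t)) volume a b := by
        simpa using h3.comp_add_right t
      refine ⟨h5.sub h1, ?_⟩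
      rw [intervalIntegral.integral_sub h5 h1,
        intervalIntegral.integral_comp_add_right (fun x => G (i + 1) x), ← h2, ← h4]
      ring
    rw [diff_succ]
    refine (ih hG').trans ?_
    rw [pow_succ, mul_assoc]
    gcongr
    exact hG.eLpNorm_sub_le hp (Nat.lt_succ_self m) t

/-! ### Series of integer translates -/

/-- The coefficients `∫ ψ(u - k) f(u) du`, `k ∈ ℤ`. -/
noncomputable def coef (ψ f : ℝ → ℝ) (k : ℤ) : ℝ := ∫ u, ψ (u - k) * f u

/-- The series `∑ₖ φ(x - k) cₖ`. -/
noncomputable def synth (φ : ℝ → ℝ) (c : ℤ → ℝ) (x : ℝ) : ℝ := ∑' k : ℤ, φ (x - k) * c k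

theorem one_add_abs_add_le (a b : ℝ) : 1 + |a + b| ≤ (1 + |a|) * (1 + |b|) := by
  have := abs_add_le a b
  nlinarith [abs_nonneg a, abs_nonneg b, mul_nonneg (abs_nonneg a) (abs_nonneg b)]

theorem one_add_abs_sub_le (a b : ℝ) : 1 + |a - b| ≤ (1 + |a|) * (1 + |b|) := by
  simpa [sub_eq_add_neg] using one_add_abs_add_le a (-b)

theorem enorm_le_enorm_of_abs_le {a b : ℝ} (h : |a| ≤ |b|) : ‖a‖ₑ ≤ ‖b‖ₑ := by
  rw [← ofReal_norm, ← ofReal_norm]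
  exact ENNReal.ofReal_le_ofReal h

/-- Unfolding the sum over translates leaves the integral of `|η|` against a counting function, which
is bounded by `tsum_indicator_uIoc_le`. -/
theorem tsum_setLIntegral_uIoc_lt_top {η : ℝ → ℝ} (hη : Integrable η) (a b : ℝ) :
    ∑' k : ℤ, ∫⁻ x in Set.uIoc a b, ‖η (x - k)‖ₑ < ∞ := by
  have hm : ∀ k : ℤ, Measurable fun y : ℝ => (Set.uIoc a b).indicator (1 : ℝ → ℝ≥0∞) (y - k) :=
    fun k => measurable_indicator_uIoc (by fun_prop) (by fun_prop) (by fun_prop)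
  have h1 : ∀ k : ℤ, ∫⁻ x in Set.uIoc a b, ‖η (x - (-k : ℤ))‖ₑ
      = ∫⁻ y, (Set.uIoc a b).indicator (1 : ℝ → ℝ≥0∞) (y - k) * ‖η y‖ₑ := by
    intro k
    rw [← lintegral_indicator measurableSet_uIoc,
      ← lintegral_sub_right_eq_self (fun x => (Set.uIoc a b).indicator _ x) (k : ℝ)]
    congr 1
    ext y
    by_cases hy : y - k ∈ Set.uIoc a b <;> simp [hy]
  rw [← (Equiv.neg ℤ).tsum_eq]
  simp only [Equiv.neg_apply]
  simp_rw [h1]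
  refine (lintegral_tsum fun k =>
    (hm k).aemeasurable.mul hη.aestronglyMeasurable.enorm).symm.trans_lt ?_
  calc _ ≤ ∫⁻ y, (‖b - a‖ₑ + 1) * ‖η y‖ₑ := by
        apply lintegral_mono
        intro y
        simp only [Pi.mul_apply]
        rw [ENNReal.tsum_mul_right]
        gcongr
        exact tsum_indicator_uIoc_le a b y
    _ = (‖b - a‖ₑ + 1) * ∫⁻ y, ‖η y‖ₑ := lintegral_const_mul'' _ hη.aestronglyMeasurable.enorm
    _ < ∞ := ENNReal.mul_lt_top (by simp) hη.2

/-- Series of translates with coefficients of polynomial growth may be differentiated term by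
term. -/
theorem PrimitiveChain.synth {m n : ℕ} {Φ : ℕ → ℝ → ℝ} (hΦ : PrimitiveChain m Φ)
    (hmeas : ∀ i, Measurable (Φ i)) {c : ℤ → ℝ}
    (hs : ∀ i < m, ∀ x, Summable fun k : ℤ => Φ i (x - k) * c k)
    {B : ℝ} (hc : ∀ k : ℤ, |c k| ≤ B * (1 + |(k : ℝ)|) ^ n)
    (hint : ∀ i < m, Integrable fun x => (1 + |x|) ^ n * Φ (i + 1) x) :
    PrimitiveChain m fun i => synth (Φ i) c := by
  intro i hi a b
  have hB : 0 ≤ B := by simpa using (abs_nonneg _).trans (hc 0)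
  set R : ℝ := |a| + |b| with hR
  -- `1 + |k| ≤ (1 + R) (1 + |x - k|)` turns the growth of `c` into a weight on `Φ (i + 1)`
  set D : ℝ := B * (1 + R) ^ n with hD
  have hD0 : 0 ≤ D := by positivity
  set μ := volume.restrict (Set.uIoc a b) with hμ
  set F : ℤ → ℝ → ℝ := fun k x => Φ (i + 1) (x - k) * c k with hF
  have hFm : ∀ k, Measurable (F k) := fun k =>
    ((hmeas (i + 1)).comp (by fun_prop)).mul_const _
  have hpt : ∀ k : ℤ, ∀ x ∈ Set.uIoc a b,
      ‖F k x‖ₑ ≤ ‖D * ((1 + |x - k|) ^ n * Φ (i + 1) (x - k))‖ₑ := by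
    intro k x hx
    apply enorm_le_enorm_of_abs_le
    have hxR : |x| ≤ R := by
      have h := Set.uIoc_subset_uIcc hx
      rw [Set.mem_uIcc] at h
      rw [abs_le]
      rcases h with h | h <;>
        constructor <;> linarith [neg_abs_le a, neg_abs_le b, le_abs_self a, le_abs_self b]
    have h1 : (1 + |(k : ℝ)|) ^ n ≤ (1 + R) ^ n * (1 + |x - k|) ^ n := by
      rw [← mul_pow]
      gcongr
      have := one_add_abs_sub_le x (x - k)
      rw [sub_sub_cancel] at this
      refine this.trans ?_
      gcongr
    simp only [hF]
    rw [abs_mul, abs_mul D, abs_mul ((1 + |x - k|) ^ n), abs_of_nonneg hD0,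
      abs_of_nonneg (a := (1 + |x - k|) ^ n) (by positivity)]
    calc |Φ (i + 1) (x - k)| * |c k|
        ≤ |Φ (i + 1) (x - k)| * (B * ((1 + R) ^ n * (1 + |x - k|) ^ n)) := by
          gcongr
          exact (hc k).trans (by gcongr)
      _ = _ := by rw [hD]; ring
  have hsum : ∑' k, ∫⁻ x, ‖F k x‖ₑ ∂μ < ∞ := by
    refine lt_of_le_of_lt ?_ (tsum_setLIntegral_uIoc_lt_top ((hint i hi).const_mul D) a b)
    refine ENNReal.tsum_le_tsum fun k => ?_
    exact setLIntegral_mono' measurableSet_uIoc (hpt k)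
  have hFint : ∀ k, Integrable (F k) μ := fun k =>
    ⟨(hFm k).aestronglyMeasurable, lt_of_le_of_lt (ENNReal.le_tsum k) hsum⟩
  have hHS : HasSum (fun k => ∫ x, F k x ∂μ) (∫ x, ∑' k, F k x ∂μ) := by
    apply hasSum_integral_of_summable_integral_norm hFint
    refine (ENNReal.summable_toReal hsum.ne).congr fun k => ?_
    rw [integral_norm_eq_lintegral_enorm (hFint k).1]
  refine ⟨?_, ?_⟩
  · rw [intervalIntegrable_iff]
    refine ⟨(Measurable.tsum hFm).aestronglyMeasurable, ?_⟩
    calc ∫⁻ x, ‖∑' k, F k x‖ₑ ∂μ ≤ ∫⁻ x, ∑' k, ‖F k x‖ₑ ∂μ :=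
          lintegral_mono fun x => enorm_tsum_le_tsum_enorm
      _ = ∑' k, ∫⁻ x, ‖F k x‖ₑ ∂μ := lintegral_tsum fun k => (hFm k).enorm.aemeasurable
      _ < ∞ := hsum
  · have h1 : HasSum (fun k : ℤ => Φ i (b - k) * c k - Φ i (a - k) * c k)
        (Durrmeyer.synth (Φ i) c b - Durrmeyer.synth (Φ i) c a) :=
      (hs i hi b).hasSum.sub (hs i hi a).hasSum
    have h2 : HasSum (fun k : ℤ => Φ i (b - k) * c k - Φ i (a - k) * c k)
        (∫ x in a..b, ∑' k, F k x) := by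
      rw [intervalIntegral.intervalIntegral_eq_integral_uIoc]
      refine (hHS.const_smul (if a ≤ b then (1 : ℝ) else -1)).congr_fun ?_
      intro k
      rw [← intervalIntegral.intervalIntegral_eq_integral_uIoc,
        intervalIntegral.integral_mul_const,
        intervalIntegral.integral_comp_sub_right (fun x => Φ (i + 1) x), ← (hΦ i hi _ _).2, sub_mul]
    exact h1.unique h2

/-! ### The Bernstein inequality -/

/-- The properties of the derivatives `Φ i` of the discrete kernel and of the continuous kernel `ψ`
on which the Bernstein inequalities of order `n + 1` in `L^p` rest. The row bound is void for
`p = 1` and the column bound for `p = ∞`; since they may then be infinite, they are existentially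
quantified in `ℝ≥0∞`. The column bound holds almost everywhere, so that it survives a change of `ψ` on a
null set. -/
structure KernelPair (n : ℕ) (p : ℝ≥0∞) (Φ : ℕ → ℝ → ℝ) (ψ : ℝ → ℝ) : Prop where
  measurable : ∀ i, Measurable (Φ i)
  chain : PrimitiveChain (n + 1) Φ
  summable : ∀ i ≤ n + 1, ∀ x, Summable fun k : ℤ => (1 + |(k : ℝ)|) ^ n * |Φ i (x - k)|
  integrable : ∀ i < n + 1, Integrable fun x => (1 + |x|) ^ (n + 1) * Φ (i + 1) x
  row : ∃ A : ℝ≥0∞, (1 < p → A < ∞) ∧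
    ∀ x : ℝ, ∑' k : ℤ, ‖(1 + |x - k|) ^ (n + 1) * Φ (n + 1) (x - k)‖ₑ ≤ A
  reproduces : ∀ j ≤ n, ∃ Q : Polynomial ℝ, Q.degree < (n + 1 : ℕ) ∧
    ∀ x, synth (Φ 0) (fun k => (k : ℝ) ^ j) x = Q.eval x
  measurable_dual : Measurable ψ
  integrable_dual : Integrable fun u => (1 + |u|) ^ (n + 1) * ψ u
  column : ∃ B : ℝ≥0∞, (p < ∞ → B < ∞) ∧ ∀ᵐ u, ∑' k : ℤ, ‖ψ (u - k)‖ₑ ≤ B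

theorem integrable_weight_mono {m n : ℕ} (h : n ≤ m) {ξ : ℝ → ℝ} (hξ : Measurable ξ)
    (hi : Integrable fun x => (1 + |x|) ^ m * ξ x) : Integrable fun x => (1 + |x|) ^ n * ξ x := by
  refine hi.mono (by fun_prop) (ae_of_all _ fun x => ?_)
  have : (1 + |x|) ^ n ≤ (1 + |x|) ^ m := pow_le_pow_right₀ (by linarith [abs_nonneg x]) h
  rw [norm_mul, norm_mul, Real.norm_of_nonneg (r := (1 + |x|) ^ n) (by positivity),
    Real.norm_of_nonneg (r := (1 + |x|) ^ m) (by positivity)]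
  gcongr

theorem rpow_mul_rpow_lt_top {p : ℝ≥0∞} (hp : 1 ≤ p) {A B : ℝ≥0∞} (hA : 1 < p → A < ∞)
    (hB : p < ∞ → B < ∞) : A ^ (1 - 1 / p.toReal) * B ^ (1 / p.toReal) < ∞ := by
  rcases eq_or_ne p ∞ with rfl | hp'
  · simpa using hA (by simp)
  · have h1 := one_le_toReal hp hp'
    refine ENNReal.mul_lt_top ?_ (ENNReal.rpow_lt_top_of_nonneg (by positivity)
      (hB (lt_top_iff_ne_top.2 hp')).ne)
    rcases hp.eq_or_lt with rfl | hp1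
    · simp
    · refine ENNReal.rpow_lt_top_of_nonneg ?_ (hA hp1).ne
      rw [sub_nonneg, div_le_one (by linarith)]
      exact h1

namespace KernelPair

variable {n : ℕ} {p : ℝ≥0∞} {Φ : ℕ → ℝ → ℝ} {ψ : ℝ → ℝ}

theorem integrable_psi (H : KernelPair n p Φ ψ) : Integrable ψ := by
  simpa using integrable_weight_mono (Nat.zero_le _) H.measurable_dual H.integrable_dual

/-- The functional `f ↦ ∫ ψ(u - k) f(u) du` is defined on `L^p` and bounded uniformly in `k`. For
`p < ∞` this uses `|ψ f| ≤ |ψ| + B |f|^p`. -/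
theorem integrable_coef (H : KernelPair n p Φ ψ) (hp : 1 ≤ p) {f : ℝ → ℝ}
    (hf : MemLp f p volume) : (∀ k : ℤ, Integrable fun u => ψ (u - k) * f u) ∧
      ∃ B : ℝ, ∀ k : ℤ, |coef ψ f k| ≤ B := by
  have hψ := H.integrable_psi
  have hψk : ∀ k : ℤ, Integrable fun u => ψ (u - k) := fun k => hψ.comp_sub_right (k : ℝ)
  suffices h : ∃ a : ℝ, ∃ g : ℝ → ℝ, Integrable g ∧
      ∀ k : ℤ, ∀ᵐ u, ‖ψ (u - k) * f u‖ ≤ a * |ψ (u - k)| + g u by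
    obtain ⟨a, g, hg, h⟩ := h
    have hdom : ∀ k : ℤ, Integrable fun u => a * |ψ (u - k)| + g u := fun k =>
      ((hψk k).abs.const_mul a).add hg
    have hint : ∀ k : ℤ, Integrable fun u => ψ (u - k) * f u := fun k =>
      (hdom k).mono' ((hψk k).1.mul hf.1) (h k)
    refine ⟨hint, a * (∫ u, |ψ u|) + ∫ u, g u, fun k => ?_⟩
    calc |coef ψ f k| ≤ ∫ u, a * |ψ (u - k)| + g u :=
          norm_integral_le_of_norm_le (hdom k) (h k)
      _ = _ := by
        rw [integral_add ((hψk k).abs.const_mul a) hg, integral_const_mul,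
          integral_sub_right_eq_self (fun u => |ψ u|)]
  rcases eq_or_ne p ∞ with rfl | hp'
  · refine ⟨(eLpNormEssSup f volume).toReal, 0, integrable_zero _ _ _, fun k => ?_⟩
    have hfin : eLpNormEssSup f volume ≠ ∞ := by
      rw [← eLpNorm_exponent_top]; exact hf.2.ne
    filter_upwards [ae_le_eLpNormEssSup (f := f) (μ := volume)] with u hu
    have : |f u| ≤ (eLpNormEssSup f volume).toReal := by
      have := ENNReal.toReal_mono hfin hu
      simpa using this
    rw [Real.norm_eq_abs, abs_mul, Pi.zero_apply, add_zero, mul_comm]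
    gcongr
  · obtain ⟨B, hB, hcol⟩ := H.column
    have hB := hB (lt_top_iff_ne_top.2 hp')
    have h1 := one_le_toReal hp hp'
    refine ⟨1, fun u => B.toReal * ‖f u‖ ^ p.toReal,
      (hf.integrable_norm_rpow (zero_lt_one.trans_le hp).ne' hp').const_mul _, fun k => ?_⟩
    filter_upwards [hcol] with u hu
    have hψB : |ψ (u - k)| ≤ B.toReal := by
      have := ENNReal.toReal_mono hB.ne ((ENNReal.le_tsum k).trans hu)
      simpa using this
    rw [Real.norm_eq_abs, abs_mul, one_mul, Real.norm_eq_abs]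
    rcases le_total |f u| 1 with h | h
    · have h2 : 0 ≤ B.toReal * |f u| ^ p.toReal := by positivity
      nlinarith [abs_nonneg (ψ (u - k))]
    · have h2 : |f u| ≤ |f u| ^ p.toReal := by
        simpa using Real.rpow_le_rpow_of_exponent_le h h1
      have h3 : |ψ (u - k)| * |f u| ≤ B.toReal * |f u| ^ p.toReal :=
        mul_le_mul hψB h2 (abs_nonneg _) (by positivity)
      linarith [abs_nonneg (ψ (u - k))]

theorem summable_mul (H : KernelPair n p Φ ψ) {c : ℤ → ℝ} {B : ℝ} {j : ℕ} (hj : j ≤ n)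
    (hc : ∀ k : ℤ, |c k| ≤ B * (1 + |(k : ℝ)|) ^ j) {i : ℕ} (hi : i ≤ n + 1) (x : ℝ) :
    Summable fun k : ℤ => Φ i (x - k) * c k := by
  have hB : 0 ≤ B := by simpa using (abs_nonneg _).trans (hc 0)
  refine ((H.summable i hi x).mul_left B).of_norm_bounded fun k => ?_
  have h2 : (1 + |(k : ℝ)|) ^ j ≤ (1 + |(k : ℝ)|) ^ n :=
    pow_le_pow_right₀ (by linarith [abs_nonneg (k : ℝ)]) hj
  rw [norm_mul, Real.norm_eq_abs, Real.norm_eq_abs]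
  calc |Φ i (x - k)| * |c k| ≤ |Φ i (x - k)| * (B * (1 + |(k : ℝ)|) ^ n) := by
        gcongr
        exact (hc k).trans (by gcongr)
    _ = _ := by ring

theorem chain_synth (H : KernelPair n p Φ ψ) {c : ℤ → ℝ} {B : ℝ} {j : ℕ} (hj : j ≤ n)
    (hc : ∀ k : ℤ, |c k| ≤ B * (1 + |(k : ℝ)|) ^ j) :
    PrimitiveChain (n + 1) fun i => synth (Φ i) c :=
  PrimitiveChain.synth H.chain H.measurable
    (fun i hi x => H.summable_mul hj hc hi.le x) hc
    fun i hi => integrable_weight_mono (by omega) (H.measurable _) (H.integrable i hi)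

theorem summable_coef (H : KernelPair n p Φ ψ) (hp : 1 ≤ p) {f : ℝ → ℝ} (hf : MemLp f p volume)
    {i : ℕ} (hi : i ≤ n + 1) (x : ℝ) : Summable fun k : ℤ => Φ i (x - k) * coef ψ f k := by
  obtain ⟨B, hB⟩ := (H.integrable_coef hp hf).2
  exact H.summable_mul (B := B) (Nat.zero_le n) (by simpa using hB) hi x

theorem chain_synth_coef (H : KernelPair n p Φ ψ) (hp : 1 ≤ p) {f : ℝ → ℝ}
    (hf : MemLp f p volume) : PrimitiveChain (n + 1) fun i => synth (Φ i) (coef ψ f) := by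
  obtain ⟨B, hB⟩ := (H.integrable_coef hp hf).2
  exact H.chain_synth (B := B) (Nat.zero_le n) (by simpa using hB)

/-- The Bernstein inequality: differentiating the unscaled operator `n + 1` times is bounded on
`L^p`. -/
theorem exists_eLpNorm_synth_le (H : KernelPair n p Φ ψ) (hp : 1 ≤ p) :
    ∃ C : ℝ≥0∞, C < ∞ ∧ ∀ f : ℝ → ℝ, MemLp f p volume →
      eLpNorm (synth (Φ (n + 1)) (coef ψ f)) p volume ≤ C * eLpNorm f p volume := by
  obtain ⟨A, hA, hrow⟩ := H.row
  obtain ⟨B, hB, hcol⟩ := H.column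
  have hψ := H.integrable_psi
  have hmΦ := H.measurable (n + 1)
  have hmψ := H.measurable_dual
  have hΦ : Integrable (Φ (n + 1)) := by
    simpa using integrable_weight_mono (Nat.zero_le _) hmΦ (H.integrable n (Nat.lt_succ_self n))
  refine ⟨(A * ∫⁻ u, ‖ψ u‖ₑ) ^ (1 - 1 / p.toReal) * ((∫⁻ x, ‖Φ (n + 1) x‖ₑ) * B) ^ (1 / p.toReal),
    rpow_mul_rpow_lt_top hp (fun h => ENNReal.mul_lt_top (hA h) hψ.2)
      (fun h => ENNReal.mul_lt_top hΦ.2 (hB h)), fun f hf => ?_⟩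
  refine eLpNorm_le_of_periodized_kernel hp (L := fun x s => ‖Φ (n + 1) x‖ₑ * ‖ψ s‖ₑ)
    (by fun_prop) hf.1 ?_ ?_ ?_
  · filter_upwards with x
    refine enorm_tsum_le_tsum_enorm.trans (ENNReal.tsum_le_tsum fun k => ?_)
    rw [enorm_mul]
    have hmf : AEMeasurable (fun s => ‖ψ (s - k)‖ₑ * ‖f s‖ₑ) volume :=
      (by fun_prop : Measurable fun s => ‖ψ (s - k)‖ₑ).aemeasurable.mul hf.1.enorm
    simp_rw [mul_assoc]
    rw [lintegral_const_mul'' _ hmf]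
    gcongr
    refine (enorm_integral_le_lintegral_enorm _).trans (le_of_eq ?_)
    simp_rw [enorm_mul]
  · intro x
    simp_rw [lintegral_const_mul _ (by fun_prop : Measurable fun s => ‖ψ s‖ₑ)]
    rw [ENNReal.tsum_mul_right]
    gcongr
    refine le_trans (ENNReal.tsum_le_tsum fun k => ?_) (hrow x)
    apply enorm_le_enorm_of_abs_le
    rw [abs_mul, abs_of_nonneg (a := (1 + |x - k|) ^ (n + 1)) (by positivity)]
    exact le_mul_of_one_le_left (abs_nonneg _) (one_le_pow₀ (by linarith [abs_nonneg (x - k)]))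
  · filter_upwards [hcol] with s hs
    simp_rw [lintegral_mul_const _ (by fun_prop : Measurable fun x => ‖Φ (n + 1) x‖ₑ)]
    rw [ENNReal.tsum_mul_left]
    gcongr

end KernelPair

/-! ### Simultaneous approximation -/

namespace KernelPair

variable {n : ℕ} {p : ℝ≥0∞} {Φ : ℕ → ℝ → ℝ} {ψ : ℝ → ℝ}

/-- Reproduction of polynomials by the discrete kernel, differentiated `n + 1` times. -/
theorem ae_hasSum_pow (H : KernelPair n p Φ ψ) :
    ∀ᵐ x, ∀ j ≤ n, HasSum (fun k : ℤ => Φ (n + 1) (x - k) * (k : ℝ) ^ j) 0 := by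
  rw [ae_all_iff]
  intro j
  by_cases hj : j ≤ n
  swap
  · exact ae_of_all _ fun x h => absurd h hj
  have hc : ∀ k : ℤ, |(k : ℝ) ^ j| ≤ 1 * (1 + |(k : ℝ)|) ^ j := fun k => by
    rw [abs_pow, one_mul]
    gcongr
    linarith
  obtain ⟨Q, hQ, hQ'⟩ := H.reproduces j hj
  filter_upwards [(H.chain_synth hj hc).ae_eq_zero_of_polynomial hQ (ae_of_all _ hQ')] with x hx _
  have := (H.summable_mul hj hc le_rfl x).hasSum
  rwa [show ∑' k : ℤ, Φ (n + 1) (x - k) * (k : ℝ) ^ j = 0 from hx] at this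

theorem integrable_dual_mul_pow (H : KernelPair n p Φ ψ) {i : ℕ} (hi : i ≤ n + 1) (y : ℝ) :
    Integrable fun v => ψ v * (v - y) ^ i := by
  have h1 := (integrable_weight_mono hi H.measurable_dual H.integrable_dual).const_mul ((1 + |y|) ^ i)
  have hm := H.measurable_dual
  refine h1.mono (by fun_prop) (ae_of_all _ fun v => ?_)
  have h2 : |v - y| ^ i ≤ (1 + |y|) ^ i * (1 + |v|) ^ i := by
    rw [← mul_pow]
    gcongr
    have := one_add_abs_sub_le v y
    linarith
  rw [norm_mul, norm_mul, norm_mul, norm_pow, Real.norm_of_nonneg (r := (1 + |y|) ^ i) (by positivity),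
    Real.norm_of_nonneg (r := (1 + |v|) ^ i) (by positivity), Real.norm_eq_abs, Real.norm_eq_abs]
  calc |ψ v| * |v - y| ^ i ≤ |ψ v| * ((1 + |y|) ^ i * (1 + |v|) ^ i) := by gcongr
    _ = _ := by ring

theorem integrable_dual_shift_mul_pow (H : KernelPair n p Φ ψ) {i : ℕ} (hi : i ≤ n + 1) (x : ℝ)
    (k : ℤ) : Integrable fun u => ψ (u - k) * (u - x) ^ i := by
  have := (H.integrable_dual_mul_pow hi (x - k)).comp_sub_right (k : ℝ)
  simpa using this

/-- The coefficients of a polynomial depend polynomially on `k`. -/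
theorem coef_sub_pow (H : KernelPair n p Φ ψ) {i : ℕ} (hi : i ≤ n) (x : ℝ) (k : ℤ) :
    coef ψ (fun u => (u - x) ^ i) k = ∑ j ∈ Finset.range (i + 1),
      (k : ℝ) ^ j * ((∫ v, ψ v * (v - x) ^ (i - j)) * i.choose j) := by
  calc coef ψ (fun u => (u - x) ^ i) k = ∫ v, ψ v * (k + (v - x)) ^ i := by
        rw [coef, ← integral_add_right_eq_self _ (k : ℝ)]
        congr 1
        ext v
        rw [add_sub_cancel_right]
        congr 2
        ring
    _ = ∫ v, ∑ j ∈ Finset.range (i + 1), (k : ℝ) ^ j * (ψ v * (v - x) ^ (i - j) * i.choose j) := by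
        congr 1
        ext v
        rw [add_pow, Finset.mul_sum]
        refine Finset.sum_congr rfl fun j _ => ?_
        ring
    _ = _ := by
        rw [integral_finsetSum]
        · refine Finset.sum_congr rfl fun j _ => ?_
          rw [integral_const_mul, integral_mul_const]
        · intro j _
          exact ((H.integrable_dual_mul_pow (by omega) x).mul_const _).const_mul _

/-- At almost every `x`, subtracting from `G 0` its Taylor polynomial at `x` does not change the
value at `x` of the `(n + 1)`-st derivative of the operator. -/
theorem ae_hasSum_taylor (H : KernelPair n p Φ ψ) (hp : 1 ≤ p) {G : ℕ → ℝ → ℝ}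
    (hG0 : MemLp (G 0) p volume) :
    ∀ᵐ x, HasSum (fun k : ℤ => Φ (n + 1) (x - k) * ∫ u, ψ (u - k) *
        (G 0 u - ∑ i ∈ Finset.range (n + 1), G i x * ((u - x) ^ i / i.factorial)))
      (synth (Φ (n + 1)) (coef ψ (G 0)) x) := by
  filter_upwards [H.ae_hasSum_pow] with x hx
  have h1 : ∀ i ∈ Finset.range (n + 1), HasSum (fun k : ℤ => Φ (n + 1) (x - k) *
      (coef ψ (fun u => (u - x) ^ i) k * (G i x / i.factorial))) 0 := by
    intro i hi
    have hi' : i ≤ n := by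
      have := Finset.mem_range.1 hi
      omega
    have h2 : HasSum (fun k : ℤ => ∑ j ∈ Finset.range (i + 1), Φ (n + 1) (x - k) * (k : ℝ) ^ j *
        ((∫ v, ψ v * (v - x) ^ (i - j)) * i.choose j * (G i x / i.factorial)))
        (∑ j ∈ Finset.range (i + 1), 0 *
          ((∫ v, ψ v * (v - x) ^ (i - j)) * i.choose j * (G i x / i.factorial))) := by
      refine hasSum_sum fun j hj => ?_
      have := Finset.mem_range.1 hj
      exact (hx j (by omega)).mul_right _
    simp only [zero_mul, Finset.sum_const_zero] at h2
    refine h2.congr_fun fun k => ?_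
    rw [H.coef_sub_pow hi' x k, Finset.sum_mul, Finset.mul_sum]
    refine Finset.sum_congr rfl fun j _ => ?_
    ring
  have h3 := (H.summable_coef hp hG0 le_rfl x).hasSum.sub (hasSum_sum h1)
  rw [Finset.sum_const_zero, sub_zero] at h3
  refine h3.congr_fun fun k => ?_
  have hint : ∀ i ∈ Finset.range (n + 1),
      Integrable fun u => ψ (u - k) * (u - x) ^ i * (G i x / i.factorial) := fun i hi =>
    (H.integrable_dual_shift_mul_pow (Finset.mem_range.1 hi).le x k).mul_const _
  have h4 : ∀ u, ψ (u - k) *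
      (G 0 u - ∑ i ∈ Finset.range (n + 1), G i x * ((u - x) ^ i / i.factorial))
      = ψ (u - k) * G 0 u
        - ∑ i ∈ Finset.range (n + 1), ψ (u - k) * (u - x) ^ i * (G i x / i.factorial) := by
    intro u
    rw [mul_sub, Finset.mul_sum]
    congr 1
    refine Finset.sum_congr rfl fun i _ => ?_
    ring
  simp_rw [h4]
  rw [integral_sub ((H.integrable_coef hp hG0).1 k) (integrable_finsetSum _ hint),
    integral_finsetSum _ hint, mul_sub, Finset.mul_sum]
  simp_rw [integral_mul_const]
  rfl

theorem enorm_sub_taylor_le {G : ℕ → ℝ → ℝ} (hG : PrimitiveChain (n + 1) G) (x u : ℝ) :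
    ‖G 0 u - ∑ i ∈ Finset.range (n + 1), G i x * ((u - x) ^ i / i.factorial)‖ₑ
      ≤ ‖u - x‖ₑ ^ n
        * ∫⁻ s, (Set.uIoc x u).indicator (1 : ℝ → ℝ≥0∞) s * ‖G (n + 1) s‖ₑ := by
  have hI : Integrable (G (n + 1)) (volume.restrict (Set.uIoc x u)) :=
    (hG n (Nat.lt_succ_self n) x u).1.def'
  have h1 : ∫⁻ s, (Set.uIoc x u).indicator (1 : ℝ → ℝ≥0∞) s * ‖G (n + 1) s‖ₑ
      = ENNReal.ofReal (∫ s in Set.uIoc x u, |G (n + 1) s|) := by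
    have := ofReal_integral_norm_eq_lintegral_enorm hI
    simp only [Real.norm_eq_abs] at this
    rw [this, ← lintegral_indicator measurableSet_uIoc]
    congr 1
    ext s
    by_cases hs : s ∈ Set.uIoc x u <;> simp [hs]
  rw [h1, ← ofReal_norm, ← ofReal_norm, ← ENNReal.ofReal_pow (norm_nonneg _),
    ← ENNReal.ofReal_mul (by positivity)]
  exact ENNReal.ofReal_le_ofReal (hG.abs_sub_taylor_le x u)

/-- The factor `‖u - y‖ₑ + 1` comes from counting integers in the interval between `y` and `u`. -/
theorem enorm_weight_le (a b y u : ℝ) :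
    ‖a‖ₑ * ‖b‖ₑ * ‖u - y‖ₑ ^ n * (‖u - y‖ₑ + 1)
      ≤ ‖(1 + |y|) ^ (n + 1) * a‖ₑ * ‖(1 + |u|) ^ (n + 1) * b‖ₑ := by
  have h1 : ‖u - y‖ₑ + 1 = ‖|u - y| + 1‖ₑ := by
    rw [Real.enorm_eq_ofReal (r := |u - y| + 1) (by positivity), ENNReal.ofReal_add (abs_nonneg _) zero_le_one,
      ENNReal.ofReal_one, ← Real.norm_eq_abs, ofReal_norm]
  rw [h1, ← enorm_pow, ← enorm_mul, ← enorm_mul, ← enorm_mul, ← enorm_mul]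
  apply enorm_le_enorm_of_abs_le
  have h2 : |u - y| + 1 ≤ (1 + |y|) * (1 + |u|) := by
    have := one_add_abs_sub_le u y
    linarith
  have h3 : |u - y| ^ n * (|u - y| + 1) ≤ (1 + |y|) ^ (n + 1) * (1 + |u|) ^ (n + 1) := by
    rw [← mul_pow, pow_succ]
    gcongr
    linarith [abs_nonneg (u - y)]
  rw [abs_mul, abs_mul, abs_mul, abs_mul, abs_mul, abs_mul, abs_pow, abs_of_nonneg (a := |u - y| + 1) (by positivity),
    abs_of_nonneg (a := (1 + |y|) ^ (n + 1)) (by positivity),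
    abs_of_nonneg (a := (1 + |u|) ^ (n + 1)) (by positivity)]
  calc |a| * |b| * |u - y| ^ n * (|u - y| + 1) = |a| * |b| * (|u - y| ^ n * (|u - y| + 1)) := by ring
    _ ≤ |a| * |b| * ((1 + |y|) ^ (n + 1) * (1 + |u|) ^ (n + 1)) := by gcongr
    _ = _ := by ring

/-- The kernel bounding the Taylor remainder of the simultaneous approximation argument, before
integration over `u`. -/
noncomputable def remainderKernel (n : ℕ) (φ ψ : ℝ → ℝ) (x u s : ℝ) : ℝ≥0∞ :=
  ‖φ x‖ₑ * ‖ψ u‖ₑ * ‖u - x‖ₑ ^ n * (Set.uIoc x u).indicator 1 s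

theorem measurable_remainderKernel {φ ψ : ℝ → ℝ} (hφ : Measurable φ) (hψ : Measurable ψ)
    {β : Type*} [MeasurableSpace β] {a b c : β → ℝ} (ha : Measurable a) (hb : Measurable b)
    (hc : Measurable c) : Measurable fun z => remainderKernel n φ ψ (a z) (b z) (c z) := by
  unfold remainderKernel
  exact Measurable.mul (by fun_prop) (measurable_indicator_uIoc ha hb hc)

theorem lintegral_remainderKernel_le (φ ψ : ℝ → ℝ) (x u : ℝ) :
    ∫⁻ s, remainderKernel n φ ψ x u s
      ≤ ‖(1 + |x|) ^ (n + 1) * φ x‖ₑ * ‖(1 + |u|) ^ (n + 1) * ψ u‖ₑ := by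
  unfold remainderKernel
  rw [lintegral_const_mul _ (measurable_indicator_uIoc (by fun_prop) (by fun_prop)
    (by fun_prop)), lintegral_indicator_one measurableSet_uIoc, Real.volume_uIoc,
    ← Real.norm_eq_abs, ofReal_norm]
  refine le_trans ?_ (enorm_weight_le _ _ x u)
  gcongr
  exact le_self_add

theorem tsum_remainderKernel_le (φ ψ : ℝ → ℝ) (x u s : ℝ) :
    ∑' k : ℤ, remainderKernel n φ ψ x u (s - k)
      ≤ ‖(1 + |x|) ^ (n + 1) * φ x‖ₑ * ‖(1 + |u|) ^ (n + 1) * ψ u‖ₑ := by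
  unfold remainderKernel
  rw [ENNReal.tsum_mul_left]
  refine le_trans ?_ (enorm_weight_le _ _ x u)
  gcongr
  exact tsum_indicator_uIoc_le x u s

theorem lintegral_remainderKernel_shift (φ ψ : ℝ → ℝ) (x s : ℝ) (k : ℤ) :
    ∫⁻ u, remainderKernel n φ ψ (x - k) u (s - k) = ∫⁻ u, ‖φ (x - k)‖ₑ * ‖ψ (u - k)‖ₑ *
      ‖u - x‖ₑ ^ n * (Set.uIoc x u).indicator (1 : ℝ → ℝ≥0∞) s := by
  rw [← lintegral_sub_right_eq_self _ (k : ℝ)]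
  congr 1
  ext u
  unfold remainderKernel
  rw [sub_sub_sub_cancel_right]
  congr 1
  have : s - k ∈ Set.uIoc (x - k) (u - k) ↔ s ∈ Set.uIoc x u := by
    simp only [Set.mem_uIoc, sub_lt_sub_iff_right, sub_le_sub_iff_right]
  by_cases hs : s ∈ Set.uIoc x u
  · simp [hs, this.2 hs]
  · simp [hs, mt this.1 hs]

theorem enorm_mul_integral_taylor_le {φ ψ : ℝ → ℝ} (hψ : Measurable ψ) {G : ℕ → ℝ → ℝ}
    (hG : PrimitiveChain (n + 1) G) (x : ℝ) (k : ℤ) :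
    ‖φ (x - k) * ∫ u, ψ (u - k) *
        (G 0 u - ∑ i ∈ Finset.range (n + 1), G i x * ((u - x) ^ i / i.factorial))‖ₑ
      ≤ ∫⁻ s, (∫⁻ u, remainderKernel n φ ψ (x - k) u (s - k)) * ‖G (n + 1) s‖ₑ := by
  have hh := (hG.locallyIntegrable (Nat.lt_succ_self n)).aestronglyMeasurable
  simp_rw [lintegral_remainderKernel_shift]
  have hmeas : Measurable fun z : ℝ × ℝ => ‖φ (x - k)‖ₑ * ‖ψ (z.1 - k)‖ₑ *
      ‖z.1 - x‖ₑ ^ n * (Set.uIoc x z.1).indicator (1 : ℝ → ℝ≥0∞) z.2 :=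
    Measurable.mul (by fun_prop)
      (measurable_indicator_uIoc (by fun_prop) (by fun_prop) (by fun_prop))
  have hind : ∀ u, AEMeasurable
      (fun s => (Set.uIoc x u).indicator (1 : ℝ → ℝ≥0∞) s * ‖G (n + 1) s‖ₑ) volume := fun u =>
    (measurable_indicator_uIoc (by fun_prop) (by fun_prop) (by fun_prop)).aemeasurable.mul
      hh.enorm
  calc ‖φ (x - k) * ∫ u, ψ (u - k) *
        (G 0 u - ∑ i ∈ Finset.range (n + 1), G i x * ((u - x) ^ i / i.factorial))‖ₑ
      ≤ ‖φ (x - k)‖ₑ * ∫⁻ u, ‖ψ (u - k)‖ₑ * (‖u - x‖ₑ ^ n *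
        ∫⁻ s, (Set.uIoc x u).indicator (1 : ℝ → ℝ≥0∞) s * ‖G (n + 1) s‖ₑ) := by
        rw [enorm_mul]
        gcongr
        refine (enorm_integral_le_lintegral_enorm _).trans (lintegral_mono fun u => ?_)
        simp only
        rw [enorm_mul]
        gcongr
        exact enorm_sub_taylor_le hG x u
    _ = ∫⁻ u, ∫⁻ s, ‖φ (x - k)‖ₑ * ‖ψ (u - k)‖ₑ * ‖u - x‖ₑ ^ n *
        (Set.uIoc x u).indicator (1 : ℝ → ℝ≥0∞) s * ‖G (n + 1) s‖ₑ := by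
        rw [← lintegral_const_mul' _ _ enorm_ne_top]
        congr 1
        ext u
        rw [← mul_assoc, ← mul_assoc, ← lintegral_const_mul'' _ (hind u)]
        simp_rw [mul_assoc]
    _ = ∫⁻ s, ∫⁻ u, ‖φ (x - k)‖ₑ * ‖ψ (u - k)‖ₑ * ‖u - x‖ₑ ^ n *
        (Set.uIoc x u).indicator (1 : ℝ → ℝ≥0∞) s * ‖G (n + 1) s‖ₑ :=
      lintegral_lintegral_swap (hmeas.aemeasurable.mul hh.enorm.comp_snd)
    _ = _ := by
      congr 1
      ext s
      exact lintegral_mul_const' _ _ enorm_ne_top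

/-- Simultaneous approximation: the derivative of order `n + 1` of the image of `G 0` under the
unscaled operator is bounded in `L^p` by the derivative of that order of `G 0`. -/
theorem exists_eLpNorm_synth_le_derivative (H : KernelPair n p Φ ψ) (hp : 1 ≤ p) :
    ∃ C : ℝ≥0∞, C < ∞ ∧ ∀ G : ℕ → ℝ → ℝ, PrimitiveChain (n + 1) G → MemLp (G 0) p volume →
      eLpNorm (synth (Φ (n + 1)) (coef ψ (G 0))) p volume ≤ C * eLpNorm (G (n + 1)) p volume := by
  obtain ⟨A, hA, hrow⟩ := H.row
  have hmΦ := H.measurable (n + 1)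
  have hmψ := H.measurable_dual
  set φ := Φ (n + 1) with hφ
  set I : ℝ≥0∞ := ∫⁻ u, ‖(1 + |u|) ^ (n + 1) * ψ u‖ₑ with hI
  set J : ℝ≥0∞ := ∫⁻ x, ‖(1 + |x|) ^ (n + 1) * φ x‖ₑ with hJ
  have hIfin : I < ∞ := H.integrable_dual.2
  have hJfin : J < ∞ := (H.integrable n (Nat.lt_succ_self n)).2
  refine ⟨(A * I) ^ (1 - 1 / p.toReal) * (J * I) ^ (1 / p.toReal),
    rpow_mul_rpow_lt_top hp (fun h => ENNReal.mul_lt_top (hA h) hIfin)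
      (fun _ => ENNReal.mul_lt_top hJfin hIfin), fun G hG hG0 => ?_⟩
  have hh := (hG.locallyIntegrable (Nat.lt_succ_self n)).aestronglyMeasurable
  refine eLpNorm_le_of_periodized_kernel hp
    (L := fun x s => ∫⁻ u, remainderKernel n φ ψ x u s) ?_ hh ?_ ?_ ?_
  · exact (measurable_remainderKernel hmΦ hmψ (by fun_prop : Measurable fun z : (ℝ × ℝ) × ℝ => z.1.1)
      (by fun_prop : Measurable fun z : (ℝ × ℝ) × ℝ => z.2)
      (by fun_prop : Measurable fun z : (ℝ × ℝ) × ℝ => z.1.2)).lintegral_prod_right'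
  · filter_upwards [H.ae_hasSum_taylor hp hG0] with x hx
    rw [← hx.tsum_eq]
    exact enorm_tsum_le_tsum_enorm.trans
      (ENNReal.tsum_le_tsum fun k => enorm_mul_integral_taylor_le hmψ hG x k)
  · intro x
    calc ∑' k : ℤ, ∫⁻ s, ∫⁻ u, remainderKernel n φ ψ (x - k) u s
        ≤ ∑' k : ℤ, ‖(1 + |x - k|) ^ (n + 1) * φ (x - k)‖ₑ * I := by
          refine ENNReal.tsum_le_tsum fun k => ?_
          rw [lintegral_lintegral_swap (measurable_remainderKernel hmΦ hmψ measurable_const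
            measurable_snd measurable_fst).aemeasurable,
            hI, ← lintegral_const_mul _ (by fun_prop)]
          exact lintegral_mono fun u => lintegral_remainderKernel_le φ ψ _ u
      _ = (∑' k : ℤ, ‖(1 + |x - k|) ^ (n + 1) * φ (x - k)‖ₑ) * I := ENNReal.tsum_mul_right
      _ ≤ A * I := by gcongr; exact hrow x
  · filter_upwards with s
    have hm1 : ∀ k : ℤ, Measurable fun z : ℝ × ℝ => remainderKernel n φ ψ z.1 z.2 (s - k) :=
      fun k => measurable_remainderKernel hmΦ hmψ measurable_fst measurable_snd measurable_const
    have hm2 : ∀ x (k : ℤ), Measurable fun u => remainderKernel n φ ψ x u (s - k) :=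
      fun x k => measurable_remainderKernel hmΦ hmψ measurable_const measurable_id measurable_const
    rw [← lintegral_tsum fun k => (hm1 k).lintegral_prod_right'.aemeasurable]
    calc ∫⁻ x, ∑' k : ℤ, ∫⁻ u, remainderKernel n φ ψ x u (s - k)
        ≤ ∫⁻ x, ‖(1 + |x|) ^ (n + 1) * φ x‖ₑ * I := by
          refine lintegral_mono fun x => ?_
          simp only
          rw [← lintegral_tsum fun k => (hm2 x k).aemeasurable, hI,
            ← lintegral_const_mul _ (by fun_prop)]
          exact lintegral_mono fun u => tsum_remainderKernel_le φ ψ x u s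
      _ = J * I := lintegral_mul_const _ (by fun_prop)

end KernelPair

/-! ### The scaled operators -/

theorem op_eq_synth (φ ψ f : ℝ → ℝ) {w : ℝ} (hw : 0 < w) (x : ℝ) :
    op φ ψ w f x = synth φ (coef ψ fun u => f (u / w)) (w * x) := by
  unfold op synth
  congr 1
  ext k
  congr 1
  have h := Measure.integral_comp_mul_left (fun v => ψ (v - k) * f (v / w)) w
  have h' : ∀ u : ℝ, w * u / w = u := fun u => by field_simp
  simp only [h'] at h
  rw [h, abs_of_pos (by positivity), smul_eq_mul, ← mul_assoc, mul_inv_cancel₀ hw.ne', one_mul]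
  rfl

/-- The candidate `w ^ i ∑ₖ φᵢ(w x - k) w ∫ ψ(w u - k) f(u) du` for the derivative of order `i` of
the image of `f` under the operator with parameter `w`, where `φᵢ = φ^{(i)}`. -/
noncomputable def derivOp (Φ : ℕ → ℝ → ℝ) (ψ : ℝ → ℝ) (w : ℝ) (f : ℝ → ℝ) (i : ℕ) (x : ℝ) : ℝ :=
  w ^ i * synth (Φ i) (coef ψ fun u => f (u / w)) (w * x)

theorem derivOp_zero (Φ : ℕ → ℝ → ℝ) (ψ f : ℝ → ℝ) {w : ℝ} (hw : 0 < w) :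
    derivOp Φ ψ w f 0 = op (Φ 0) ψ w f := by
  ext x
  rw [derivOp, pow_zero, one_mul, op_eq_synth _ _ _ hw]

theorem memLp_comp_div {p : ℝ≥0∞} {f : ℝ → ℝ} (hf : MemLp f p volume) {w : ℝ} (hw : 0 < w) :
    MemLp (fun u => f (u / w)) p volume := by
  obtain ⟨s, s', h, -, hs'⟩ := exists_eLpNorm_comp_mul p hw
  refine ⟨?_, ?_⟩
  · have hq : Measure.QuasiMeasurePreserving (fun u : ℝ => w⁻¹ * u) volume volume :=
      ⟨by fun_prop, by
        rw [Real.map_volume_mul_left (by positivity)]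
        exact Measure.smul_absolutelyContinuous⟩
    have := hf.1.comp_quasiMeasurePreserving hq
    refine this.congr (ae_of_all _ fun u => ?_)
    simp [div_eq_inv_mul]
  · rw [hs']
    refine ENNReal.mul_lt_top (lt_top_iff_ne_top.2 ?_) hf.2
    rintro rfl
    rcases eq_or_ne s 0 with h0 | h0
    · simp [h0] at h
    · simp [ENNReal.mul_top h0] at h

namespace KernelPair

variable {n : ℕ} {p : ℝ≥0∞} {Φ : ℕ → ℝ → ℝ} {ψ : ℝ → ℝ}

theorem chain_derivOp (H : KernelPair n p Φ ψ) (hp : 1 ≤ p) {f : ℝ → ℝ} (hf : MemLp f p volume)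
    {w : ℝ} (hw : 0 < w) : PrimitiveChain (n + 1) (derivOp Φ ψ w f) :=
  (H.chain_synth_coef hp (memLp_comp_div hf hw)).comp_mul hw.ne'

theorem measurable_derivOp (H : KernelPair n p Φ ψ) (w : ℝ) (f : ℝ → ℝ) (i : ℕ) :
    Measurable (derivOp Φ ψ w f i) := by
  have : Measurable (synth (Φ i) (coef ψ fun u => f (u / w))) :=
    Measurable.tsum fun k => ((H.measurable i).comp (by fun_prop)).mul_const _
  exact (this.comp (by fun_prop : Measurable fun x : ℝ => w * x)).const_mul _

theorem derivOp_sub (H : KernelPair n p Φ ψ) (hp : 1 ≤ p) {f g : ℝ → ℝ} (hf : MemLp f p volume)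
    (hg : MemLp g p volume) {w : ℝ} (hw : 0 < w) {i : ℕ} (hi : i ≤ n + 1) :
    derivOp Φ ψ w (fun x => f x - g x) i = fun x => derivOp Φ ψ w f i x - derivOp Φ ψ w g i x := by
  ext x
  have hf' := memLp_comp_div hf hw
  have hg' := memLp_comp_div hg hw
  have hc : ∀ k, coef ψ (fun u => f (u / w) - g (u / w)) k
      = coef ψ (fun u => f (u / w)) k - coef ψ (fun u => g (u / w)) k := fun k => by
    simp only [coef, mul_sub]
    exact integral_sub ((H.integrable_coef hp hf').1 k) ((H.integrable_coef hp hg').1 k)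
  simp only [derivOp, synth, hc, mul_sub]
  rw [(H.summable_coef hp hf' hi (w * x)).tsum_sub (H.summable_coef hp hg' hi (w * x)), mul_sub]

/-- The Bernstein inequality and the simultaneous approximation inequality at scale `w`. -/
theorem exists_eLpNorm_derivOp_le (H : KernelPair n p Φ ψ) (hp : 1 ≤ p) :
    ∃ C : ℝ, 0 ≤ C ∧ ∀ w : ℝ, 0 < w →
      (∀ f : ℝ → ℝ, MemLp f p volume → eLpNorm (derivOp Φ ψ w f (n + 1)) p volume
        ≤ ENNReal.ofReal (C * w ^ (n + 1)) * eLpNorm f p volume) ∧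
      ∀ G : ℕ → ℝ → ℝ, PrimitiveChain (n + 1) G → MemLp (G 0) p volume →
        eLpNorm (derivOp Φ ψ w (G 0) (n + 1)) p volume
          ≤ ENNReal.ofReal C * eLpNorm (G (n + 1)) p volume := by
  obtain ⟨C₁, hC₁, h₁⟩ := H.exists_eLpNorm_synth_le hp
  obtain ⟨C₂, hC₂, h₂⟩ := H.exists_eLpNorm_synth_le_derivative hp
  have hle₁ : C₁ ≤ ENNReal.ofReal (C₁ + C₂).toReal := by
    rw [ENNReal.ofReal_toReal (ENNReal.add_lt_top.2 ⟨hC₁, hC₂⟩).ne]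
    exact le_self_add
  have hle₂ : C₂ ≤ ENNReal.ofReal (C₁ + C₂).toReal := by
    rw [ENNReal.ofReal_toReal (ENNReal.add_lt_top.2 ⟨hC₁, hC₂⟩).ne]
    exact le_add_self
  refine ⟨(C₁ + C₂).toReal, ENNReal.toReal_nonneg, fun w hw => ?_⟩
  obtain ⟨s, s', hss, hs, hs'⟩ := exists_eLpNorm_comp_mul p hw
  have hnorm : ∀ f : ℝ → ℝ, eLpNorm (derivOp Φ ψ w f (n + 1)) p volume = ‖w ^ (n + 1)‖ₑ *
      (s * eLpNorm (synth (Φ (n + 1)) (coef ψ fun u => f (u / w))) p volume) := by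
    intro f
    rw [← hs, ← eLpNorm_const_smul]
    rfl
  have hwE : ‖w ^ (n + 1)‖ₑ = ENNReal.ofReal (w ^ (n + 1)) :=
    Real.enorm_eq_ofReal (by positivity)
  refine ⟨fun f hf => ?_, fun G hG hG0 => ?_⟩
  · rw [hnorm, hwE, ENNReal.ofReal_mul ENNReal.toReal_nonneg]
    calc ENNReal.ofReal (w ^ (n + 1)) *
          (s * eLpNorm (synth (Φ (n + 1)) (coef ψ fun u => f (u / w))) p volume)
        ≤ ENNReal.ofReal (w ^ (n + 1)) *
          (s * (ENNReal.ofReal (C₁ + C₂).toReal * (s' * eLpNorm f p volume))) := by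
          gcongr
          refine (h₁ _ (memLp_comp_div hf hw)).trans ?_
          rw [hs']
          gcongr
      _ = (s * s') * (ENNReal.ofReal (C₁ + C₂).toReal * ENNReal.ofReal (w ^ (n + 1))
            * eLpNorm f p volume) := by ring
      _ = _ := by rw [hss, one_mul]
  · have hchain : PrimitiveChain (n + 1) (fun i x => w⁻¹ ^ i * G i (w⁻¹ * x)) :=
      hG.comp_mul (by positivity)
    have hfun : (fun x => w⁻¹ ^ 0 * G 0 (w⁻¹ * x)) = fun x => G 0 (x / w) := by
      ext x
      rw [pow_zero, one_mul, div_eq_inv_mul]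
    have key := h₂ _ hchain (by rw [hfun]; exact memLp_comp_div hG0 hw)
    simp only [hfun] at key
    have hder : eLpNorm (fun x => w⁻¹ ^ (n + 1) * G (n + 1) (w⁻¹ * x)) p volume
        = ‖w⁻¹ ^ (n + 1)‖ₑ * (s' * eLpNorm (G (n + 1)) p volume) := by
      rw [← hs', ← eLpNorm_const_smul]
      congr 1
      ext x
      simp [div_eq_inv_mul]
    rw [hder] at key
    have hww : ‖w ^ (n + 1)‖ₑ * ‖w⁻¹ ^ (n + 1)‖ₑ = 1 := by
      rw [← enorm_mul, ← mul_pow, mul_inv_cancel₀ hw.ne', one_pow, enorm_one]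
    rw [hnorm]
    calc ‖w ^ (n + 1)‖ₑ *
          (s * eLpNorm (synth (Φ (n + 1)) (coef ψ fun u => G 0 (u / w))) p volume)
        ≤ ‖w ^ (n + 1)‖ₑ * (s * (ENNReal.ofReal (C₁ + C₂).toReal *
          (‖w⁻¹ ^ (n + 1)‖ₑ * (s' * eLpNorm (G (n + 1)) p volume)))) := by
          gcongr
          exact key.trans (by gcongr)
      _ = (s * s') * (‖w ^ (n + 1)‖ₑ * ‖w⁻¹ ^ (n + 1)‖ₑ) *
          (ENNReal.ofReal (C₁ + C₂).toReal * eLpNorm (G (n + 1)) p volume) := by ring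
      _ = _ := by rw [hss, hww, one_mul, one_mul]

end KernelPair

/-! ### The inverse theorem -/

/-- The iteration behind inverse theorems. Here `a w` is the size of the derivative of order `m` of
the approximant with parameter `w`, and `Ω δ` a modulus of smoothness of order `m`. Along a geometric
sequence of parameters with ratio large compared with `K`, the first inequality keeps `a w` of order
`w ^ (m - α)`. -/
theorem exists_forall_le_rpow_of_recursion {m : ℕ} {α K C D w₀ : ℝ} (hα : 0 < α) (hαm : α < m)
    (hK : 1 ≤ K) (hC : 0 ≤ C) (hw₀ : 0 < w₀) {a Ω : ℝ → ℝ≥0∞} (ha₀ : a w₀ < ∞)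
    (ha : ∀ w ≥ w₀, ∀ w' ≥ w₀,
      a w' ≤ ENNReal.ofReal (K * w' ^ m * (C * w ^ (-α))) + ENNReal.ofReal K * a w)
    (hD : 0 ≤ D)
    (hΩ : ∀ δ > 0, ∀ w ≥ w₀,
      Ω δ ≤ ENNReal.ofReal (D * (C * w ^ (-α))) + ENNReal.ofReal (δ ^ m) * a w) :
    ∃ N : ℝ, ∀ δ : ℝ, 0 < δ → δ ≤ 1 / w₀ → Ω δ ≤ ENNReal.ofReal (N * δ ^ α) := by
  have hβ : 0 < m - α := by linarith
  -- the ratio of the parameters, chosen so that `K * l ^ (-(m - α)) = 1 / 2`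
  set l : ℝ := (2 * K) ^ (1 / (m - α)) with hl
  have hl1 : 1 < l := Real.one_lt_rpow (by linarith) (by positivity)
  have hl0 : 0 < l := by linarith
  have hlK : l ^ (m - α) = 2 * K := by
    rw [hl, ← Real.rpow_mul (by linarith), one_div, inv_mul_cancel₀ hβ.ne', Real.rpow_one]
  set M : ℝ := (a w₀).toReal / w₀ ^ (m - α) + 2 * K * C * l ^ α with hM
  have hM0 : 0 ≤ M := by positivity
  have hM1 : (a w₀).toReal ≤ M * w₀ ^ (m - α) := by
    rw [hM, add_mul, div_mul_cancel₀ _ (by positivity)]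
    have : 0 ≤ 2 * K * C * l ^ α * w₀ ^ (m - α) := by positivity
    linarith
  have hM2 : 2 * K * C * l ^ α ≤ M := by
    rw [hM]
    have : 0 ≤ (a w₀).toReal / w₀ ^ (m - α) := by positivity
    linarith
  have hwk : ∀ k : ℕ, w₀ ≤ w₀ * l ^ k := fun k =>
    le_mul_of_one_le_right hw₀.le (one_le_pow₀ hl1.le)
  have hak : ∀ k : ℕ, a (w₀ * l ^ k) ≤ ENNReal.ofReal (M * (w₀ * l ^ k) ^ (m - α)) := by
    intro k
    induction k with
    | zero =>
      rw [pow_zero, mul_one, ← ENNReal.ofReal_toReal ha₀.ne]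
      exact ENNReal.ofReal_le_ofReal hM1
    | succ k ih =>
      refine (ha _ (hwk k) _ (hwk (k + 1))).trans ?_
      set w := w₀ * l ^ k with hw
      have hw0 : 0 < w := by positivity
      have hw' : w₀ * l ^ (k + 1) = l * w := by rw [hw]; ring
      rw [hw']
      have e1 : (l * w) ^ m * w ^ (-α) = (l * w) ^ (m - α) * l ^ α := by
        rw [Real.rpow_sub (by positivity), Real.rpow_natCast, Real.mul_rpow hl0.le hw0.le,
          Real.rpow_neg hw0.le]
        field_simp
      have e2 : 2 * K * w ^ (m - α) = (l * w) ^ (m - α) := by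
        rw [Real.mul_rpow hl0.le hw0.le, hlK]
      calc ENNReal.ofReal (K * (l * w) ^ m * (C * w ^ (-α))) + ENNReal.ofReal K * a w
          ≤ ENNReal.ofReal (K * (l * w) ^ m * (C * w ^ (-α)))
            + ENNReal.ofReal K * ENNReal.ofReal (M * w ^ (m - α)) := by gcongr
        _ = ENNReal.ofReal (K * (l * w) ^ m * (C * w ^ (-α)) + K * (M * w ^ (m - α))) := by
            rw [← ENNReal.ofReal_mul (by linarith), ← ENNReal.ofReal_add (by positivity)
              (by positivity)]
        _ ≤ ENNReal.ofReal (M * (l * w) ^ (m - α)) := by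
            apply ENNReal.ofReal_le_ofReal
            have e3 : K * (l * w) ^ m * (C * w ^ (-α))
                = (2 * K * C * l ^ α) * (l * w) ^ (m - α) / 2 := by
              linear_combination K * C * e1
            have e4 : K * (M * w ^ (m - α)) = M * (l * w) ^ (m - α) / 2 := by
              linear_combination M / 2 * e2
            rw [e3, e4]
            have : (2 * K * C * l ^ α) * (l * w) ^ (m - α) ≤ M * (l * w) ^ (m - α) := by gcongr
            linarith
  refine ⟨D * C * l ^ α + M, fun δ hδ hδ1 => ?_⟩
  have hx1 : 1 ≤ 1 / (δ * w₀) := by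
    rw [le_div_iff₀ hw₀] at hδ1
    rw [le_div_iff₀ (by positivity)]
    linarith
  -- `w = w₀ * l ^ k` is the largest parameter of the sequence with `w * δ ≤ 1`
  obtain ⟨k, hk1, hk2⟩ := exists_nat_pow_near hx1 hl1
  refine (hΩ δ hδ _ (hwk k)).trans ?_
  have hka := hak k
  set w := w₀ * l ^ k with hw
  have hw0 : 0 < w := by positivity
  have hwδ : w * δ ≤ 1 := by
    rw [le_div_iff₀ (by positivity)] at hk1
    rw [hw]
    linarith
  have hwδ' : 1 ≤ l * w * δ := by
    rw [div_lt_iff₀ (by positivity), pow_succ] at hk2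
    rw [hw]
    linarith
  have e1 : w ^ (-α) ≤ l ^ α * δ ^ α := by
    rw [Real.rpow_neg hw0.le, ← Real.mul_rpow hl0.le hδ.le, inv_le_iff_one_le_mul₀ (by positivity),
      ← Real.mul_rpow (by positivity) hw0.le]
    apply Real.one_le_rpow _ hα.le
    linarith
  have e2 : δ ^ m * w ^ (m - α) ≤ δ ^ α := by
    have h1 : (w * δ) ^ (m - α) ≤ 1 := Real.rpow_le_one (by positivity) hwδ hβ.le
    rw [Real.mul_rpow hw0.le hδ.le, Real.rpow_sub hδ, Real.rpow_natCast] at h1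
    have h2 : 0 < δ ^ α := by positivity
    calc δ ^ m * w ^ (m - α) = w ^ (m - α) * (δ ^ m / δ ^ α) * δ ^ α := by field_simp
      _ ≤ 1 * δ ^ α := by gcongr
      _ = _ := one_mul _
  calc ENNReal.ofReal (D * (C * w ^ (-α))) + ENNReal.ofReal (δ ^ m) * a w
      ≤ ENNReal.ofReal (D * (C * w ^ (-α)))
        + ENNReal.ofReal (δ ^ m) * ENNReal.ofReal (M * w ^ (m - α)) := by gcongr
    _ = ENNReal.ofReal (D * (C * w ^ (-α)) + δ ^ m * (M * w ^ (m - α))) := by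
        rw [← ENNReal.ofReal_mul (by positivity), ← ENNReal.ofReal_add (by positivity)
          (by positivity)]
    _ ≤ _ := by
        apply ENNReal.ofReal_le_ofReal
        have h1 : D * (C * w ^ (-α)) ≤ D * (C * (l ^ α * δ ^ α)) := by gcongr
        have h2 : M * (δ ^ m * w ^ (m - α)) ≤ M * δ ^ α := by gcongr
        linarith

/-- The inverse theorem in terms of the Lebesgue seminorm. -/
theorem KernelPair.inverse {n : ℕ} {p : ℝ≥0∞} {Φ : ℕ → ℝ → ℝ} {ψ : ℝ → ℝ}
    (H : KernelPair n p Φ ψ) (hp : 1 ≤ p) {α : ℝ} (hα : 0 < α) (hαn : α < n + 1) {f : ℝ → ℝ}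
    (hf : MemLp f p volume)
    (hrate : ∃ C : ℝ, ∀ᶠ w : ℝ in atTop,
      eLpNorm (fun x => op (Φ 0) ψ w f x - f x) p volume ≤ ENNReal.ofReal (C * w ^ (-α))) :
    ∃ N : ℝ, ∀ᶠ δ : ℝ in 𝓝[>] 0, ∀ t : ℝ, |t| ≤ δ →
      eLpNorm (diff (n + 1) t f) p volume ≤ ENNReal.ofReal (N * δ ^ α) := by
  obtain ⟨C', hC'⟩ := hrate
  obtain ⟨w₁, hw₁⟩ := eventually_atTop.1 hC'
  set w₀ := max w₁ 1 with hw₀def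
  have hw₀ : 0 < w₀ := lt_of_lt_of_le one_pos (le_max_right _ _)
  set C := max C' 0 with hCdef
  have hC : 0 ≤ C := le_max_right _ _
  have hrate : ∀ w ≥ w₀,
      eLpNorm (fun x => f x - derivOp Φ ψ w f 0 x) p volume ≤ ENNReal.ofReal (C * w ^ (-α)) := by
    intro w hw
    have hw0 : 0 < w := hw₀.trans_le hw
    rw [derivOp_zero _ _ _ hw0, ← eLpNorm_neg]
    refine le_trans (le_of_eq ?_) ((hw₁ w ((le_max_left _ _).trans hw)).trans ?_)
    · congr 1
      ext x
      simp
    · apply ENNReal.ofReal_le_ofReal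
      gcongr
      exact le_max_left _ _
  have hmeas : ∀ w i, AEStronglyMeasurable (derivOp Φ ψ w f i) volume := fun w i =>
    (H.measurable_derivOp w f i).aestronglyMeasurable
  have herr : ∀ w ≥ w₀, MemLp (fun x => f x - derivOp Φ ψ w f 0 x) p volume := fun w hw =>
    ⟨hf.1.sub (hmeas w 0), (hrate w hw).trans_lt ENNReal.ofReal_lt_top⟩
  have happ : ∀ w ≥ w₀, MemLp (derivOp Φ ψ w f 0) p volume := by
    intro w hw
    refine (hf.sub (herr w hw)).ae_eq (ae_of_all _ fun x => ?_)
    simp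
  obtain ⟨K', hK', hder⟩ := H.exists_eLpNorm_derivOp_le hp
  set K := max K' 1 with hKdef
  have hKK : K' ≤ K := le_max_left _ _
  have hrec : ∀ w ≥ w₀, ∀ w' ≥ w₀, eLpNorm (derivOp Φ ψ w' f (n + 1)) p volume
      ≤ ENNReal.ofReal (K * w' ^ (n + 1) * (C * w ^ (-α)))
        + ENNReal.ofReal K * eLpNorm (derivOp Φ ψ w f (n + 1)) p volume := by
    intro w hw w' hw'
    have hw0 : 0 < w' := hw₀.trans_le hw'
    have hsplit : derivOp Φ ψ w' f (n + 1)
        = derivOp Φ ψ w' (fun x => f x - derivOp Φ ψ w f 0 x) (n + 1)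
          + derivOp Φ ψ w' (derivOp Φ ψ w f 0) (n + 1) := by
      rw [H.derivOp_sub hp hf (happ w hw) hw0 le_rfl]
      ext x
      simp
    rw [hsplit]
    refine (eLpNorm_add_le (H.measurable_derivOp _ _ _).aestronglyMeasurable
      (H.measurable_derivOp _ _ _).aestronglyMeasurable hp).trans ?_
    gcongr
    · refine ((hder w' hw0).1 _ (herr w hw)).trans ?_
      rw [ENNReal.ofReal_mul (p := K * w' ^ (n + 1)) (by positivity)]
      gcongr
      exact hrate w hw
    · refine ((hder w' hw0).2 _ (H.chain_derivOp hp hf (hw₀.trans_le hw)) (happ w hw)).trans ?_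
      gcongr
  have hmod : ∀ δ > 0, ∀ w ≥ w₀,
      ⨆ t : ℝ, ⨆ _ : |t| ≤ δ, eLpNorm (diff (n + 1) t f) p volume
        ≤ ENNReal.ofReal (2 ^ (n + 1) * (C * w ^ (-α)))
          + ENNReal.ofReal (δ ^ (n + 1)) * eLpNorm (derivOp Φ ψ w f (n + 1)) p volume := by
    intro δ hδ w hw
    refine iSup₂_le fun t ht => ?_
    have hsplit : diff (n + 1) t f = diff (n + 1) t (fun x => f x - derivOp Φ ψ w f 0 x)
        + diff (n + 1) t (derivOp Φ ψ w f 0) := by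
      ext x
      simp only [diff, Pi.add_apply, ← Finset.sum_add_distrib]
      refine Finset.sum_congr rfl fun j _ => ?_
      ring
    have hmd : ∀ g : ℝ → ℝ, AEStronglyMeasurable g volume →
        AEStronglyMeasurable (diff (n + 1) t g) volume := by
      intro g hg
      unfold diff
      exact Finset.aestronglyMeasurable_fun_sum _ fun j _ =>
        (aestronglyMeasurable_translate hg _).const_mul _
    rw [hsplit]
    refine (eLpNorm_add_le (hmd _ (herr w hw).1) (hmd _ (hmeas w 0)) hp).trans ?_
    gcongr
    · refine (eLpNorm_diff_le hp (n + 1) t (herr w hw).1).trans ?_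
      rw [ENNReal.ofReal_mul (by positivity), ENNReal.ofReal_pow (by norm_num), ENNReal.ofReal_ofNat]
      gcongr
      exact hrate w hw
    · refine ((H.chain_derivOp hp hf (hw₀.trans_le hw)).eLpNorm_diff_le hp t).trans ?_
      rw [ENNReal.ofReal_pow hδ.le]
      gcongr
      rw [← ofReal_norm]
      exact ENNReal.ofReal_le_ofReal ht
  obtain ⟨N, hN⟩ := exists_forall_le_rpow_of_recursion (m := n + 1) hα (by push_cast; exact hαn)
    (le_max_right _ _) hC hw₀
    (((hder w₀ hw₀).1 f hf).trans_lt (ENNReal.mul_lt_top ENNReal.ofReal_lt_top hf.2)) hrec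
    (by positivity) hmod
  refine ⟨N, ?_⟩
  filter_upwards [Ioc_mem_nhdsGT (show (0 : ℝ) < 1 / w₀ by positivity)] with δ hδ t ht
  exact (le_iSup₂ (f := fun (t : ℝ) (_ : |t| ≤ δ) => eLpNorm (diff (n + 1) t f) p volume) t
    ht).trans (hN δ hδ.1 hδ.2)

/-! ### Decay at infinity -/

theorem Decay.exists_bound {θ : ℝ} (hθ : 0 ≤ θ) {ξ : ℝ → ℝ} (h : Decay θ ξ) :
    ∃ C R : ℝ, 0 ≤ C ∧ 0 ≤ R ∧ ∀ x, R < |x| → |ξ x| ≤ C * (1 + |x|) ^ (-θ) := by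
  obtain ⟨C, hC, hb⟩ := Asymptotics.IsBigO.exists_nonneg h
  obtain ⟨R, hR⟩ := Metric.closedBall_compl_subset_of_mem_cocompact
    (Asymptotics.isBigOWith_iff.1 hb) (0 : ℝ)
  refine ⟨C * 2 ^ θ, max R 1, by positivity, by positivity, fun x hx => ?_⟩
  have hx1 : 1 < |x| := (le_max_right _ _).trans_lt hx
  have hx0 : 0 < |x| := by linarith
  have h1 : ‖ξ x‖ ≤ C * ‖|x| ^ (-θ)‖ := hR (by
    simp only [Set.mem_compl_iff, Metric.mem_closedBall, dist_zero_right, not_le, Real.norm_eq_abs]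
    exact (le_max_left _ _).trans_lt hx)
  rw [Real.norm_eq_abs, Real.norm_of_nonneg (by positivity)] at h1
  refine h1.trans ?_
  rw [mul_assoc]
  gcongr
  rw [Real.rpow_neg hx0.le, Real.rpow_neg (by positivity), ← div_eq_mul_inv,
    ← Real.div_rpow (by norm_num) (by positivity), ← Real.inv_rpow hx0.le]
  gcongr
  rw [inv_eq_one_div, div_le_div_iff₀ hx0 (by positivity)]
  linarith

theorem one_add_abs_pow_mul_rpow (N : ℕ) (θ x : ℝ) :
    (1 + |x|) ^ N * (1 + |x|) ^ (-θ) = (1 + |x|) ^ (-(θ - N)) := by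
  have : 0 < 1 + |x| := by positivity
  rw [← Real.rpow_natCast, ← Real.rpow_add this]
  congr 1
  ring

theorem Decay.integrable_weight {θ : ℝ} {ξ : ℝ → ℝ} (h : Decay θ ξ) {N : ℕ} (hθ : (N : ℝ) + 1 < θ)
    (hξ : LocallyIntegrable ξ volume) : Integrable fun x => (1 + |x|) ^ N * ξ x := by
  have hN : (0 : ℝ) ≤ N := N.cast_nonneg
  obtain ⟨C, R, hC, hR, hb⟩ := h.exists_bound (by linarith)
  have h1 : Integrable ((Set.Icc (-R) R).indicator fun x => (1 + R) ^ N * |ξ x|) :=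
    IntegrableOn.integrable_indicator
      (((hξ.integrableOn_isCompact isCompact_Icc).norm).const_mul ((1 + R) ^ N)) measurableSet_Icc
  have h2 : Integrable fun x : ℝ => C * (1 + ‖x‖) ^ (-(θ - N)) :=
    (integrable_one_add_norm (by simp; linarith)).const_mul _
  refine (h1.add h2).mono' ?_ (ae_of_all _ fun x => ?_)
  · exact (by fun_prop : Measurable fun x : ℝ => (1 + |x|) ^ N).aestronglyMeasurable.mul
      hξ.aestronglyMeasurable
  · rw [Pi.add_apply, Real.norm_eq_abs, abs_mul, abs_of_nonneg (a := (1 + |x|) ^ N) (by positivity)]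
    have h3 : 0 ≤ C * (1 + ‖x‖) ^ (-(θ - N)) := by positivity
    by_cases hx : |x| ≤ R
    · rw [Set.indicator_of_mem (show x ∈ Set.Icc (-R) R from abs_le.1 hx)]
      have : (1 + |x|) ^ N * |ξ x| ≤ (1 + R) ^ N * |ξ x| := by gcongr
      linarith
    · rw [Set.indicator_of_notMem (show x ∉ Set.Icc (-R) R from fun h => hx (abs_le.2 h)), zero_add, Real.norm_eq_abs,
        ← one_add_abs_pow_mul_rpow]
      calc (1 + |x|) ^ N * |ξ x| ≤ (1 + |x|) ^ N * (C * (1 + |x|) ^ (-θ)) := by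
            gcongr
            exact hb x (not_le.1 hx)
        _ = _ := by ring

/-- The translates of `(1 + |·|) ^ (-σ)` sum to a bounded function; by periodicity it suffices to
compare with `(1 + |k|) ^ (-σ)` for `x` in the unit interval. -/
theorem exists_tsum_one_add_abs_le {σ : ℝ} (hσ : 1 < σ) :
    ∃ S : ℝ, 0 ≤ S ∧ ∀ x : ℝ, Summable (fun k : ℤ => (1 + |x - k|) ^ (-σ)) ∧
      ∑' k : ℤ, (1 + |x - k|) ^ (-σ) ≤ S := by
  have h0 : Summable fun k : ℤ => 2 ^ σ * (1 + |(k : ℝ)|) ^ (-σ) := by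
    refine Summable.mul_left _ ?_
    -- the shift by `1 / 2` avoids the junk value of `0 ^ (-σ)` at `k = 0`
    refine ((Real.summable_one_div_int_add_rpow (1 / 2) σ).2 hσ).of_nonneg_of_le
      (fun k => by positivity) fun k => ?_
    have h1 : 0 < |(k : ℝ) + 1 / 2| := by
      rw [abs_pos]
      intro h
      have : (2 * k + 1 : ℤ) = 0 := by
        have : (2 * (k : ℝ) + 1) = 0 := by linarith
        exact_mod_cast this
      omega
    have h2 : |(k : ℝ) + 1 / 2| ≤ 1 + |(k : ℝ)| := by
      have := abs_add_le (k : ℝ) (1 / 2)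
      rw [abs_of_pos (by norm_num : (0 : ℝ) < 1 / 2)] at this
      linarith
    rw [Real.rpow_neg (by positivity), one_div]
    gcongr
  refine ⟨∑' k : ℤ, 2 ^ σ * (1 + |(k : ℝ)|) ^ (-σ), tsum_nonneg fun k => by positivity,
    fun x => ?_⟩
  have hle : ∀ k : ℤ, (1 + |Int.fract x - k|) ^ (-σ) ≤ 2 ^ σ * (1 + |(k : ℝ)|) ^ (-σ) := by
    intro k
    have h1 : (1 + |(k : ℝ)|) / 2 ≤ 1 + |Int.fract x - k| := by
      have h2 := abs_sub_abs_le_abs_sub (k : ℝ) (Int.fract x)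
      rw [abs_sub_comm, abs_of_nonneg (Int.fract_nonneg x)] at h2
      have h3 := Int.fract_lt_one x
      have h4 := abs_nonneg (Int.fract x - k)
      linarith
    rw [Real.rpow_neg (by positivity), Real.rpow_neg (by positivity), ← div_eq_mul_inv,
      ← Real.div_rpow (by norm_num) (by positivity), ← Real.inv_rpow (by positivity)]
    gcongr
    rw [inv_le_comm₀ (by positivity) (by positivity), inv_div]
    exact h1
  have hs : Summable fun k : ℤ => (1 + |Int.fract x - k|) ^ (-σ) :=
    h0.of_nonneg_of_le (fun k => by positivity) hle
  have heq : ∀ k : ℤ, (1 + |Int.fract x - k|) ^ (-σ)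
      = (1 + |x - (Equiv.addRight ⌊x⌋ k : ℤ)|) ^ (-σ) := by
    intro k
    congr 3
    rw [Equiv.coe_addRight, Int.cast_add, Int.fract]
    ring
  refine ⟨(Equiv.addRight ⌊x⌋).summable_iff.1 (hs.congr heq), ?_⟩
  rw [← (Equiv.addRight ⌊x⌋).tsum_eq]
  calc ∑' k : ℤ, (1 + |x - (Equiv.addRight ⌊x⌋ k : ℤ)|) ^ (-σ)
      = ∑' k : ℤ, (1 + |Int.fract x - k|) ^ (-σ) := tsum_congr fun k => (heq k).symm
    _ ≤ _ := hs.tsum_le_tsum hle h0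

theorem Decay.summable_weight {θ : ℝ} {ξ : ℝ → ℝ} (h : Decay θ ξ) {N : ℕ} (hθ : (N : ℝ) + 1 < θ)
    (x : ℝ) : Summable fun k : ℤ => (1 + |(k : ℝ)|) ^ N * |ξ (x - k)| := by
  have hN : (0 : ℝ) ≤ N := N.cast_nonneg
  obtain ⟨C, R, hC, hR, hb⟩ := h.exists_bound (by linarith)
  obtain ⟨S, -, hS⟩ := exists_tsum_one_add_abs_le (σ := θ - N) (by linarith)
  refine Summable.of_norm_bounded_eventually (((hS x).1.mul_left ((1 + |x|) ^ N * C))) ?_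
  have hev : ∀ᶠ k : ℤ in cofinite, (k : ℝ) ∈ (Metric.closedBall x R)ᶜ :=
    Int.tendsto_coe_cofinite.eventually (isCompact_closedBall x R).compl_mem_cocompact
  filter_upwards [hev] with k hk
  have hk' : R < |x - k| := by
    simpa [Real.dist_eq, abs_sub_comm] using hk
  rw [Real.norm_of_nonneg (by positivity), ← one_add_abs_pow_mul_rpow]
  have h1 : 1 + |(k : ℝ)| ≤ (1 + |x|) * (1 + |x - k|) := by
    simpa using one_add_abs_sub_le x (x - k)
  calc (1 + |(k : ℝ)|) ^ N * |ξ (x - k)|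
      ≤ ((1 + |x|) * (1 + |x - k|)) ^ N * (C * (1 + |x - k|) ^ (-θ)) := by
        gcongr
        exact hb _ hk'
    _ = _ := by rw [mul_pow]; ring

theorem Decay.exists_tsum_weight_le {θ : ℝ} {ξ : ℝ → ℝ} (h : Decay θ ξ) {N : ℕ}
    (hθ : (N : ℝ) + 1 < θ) {M : ℝ} (hM : ∀ y, |ξ y| ≤ M) :
    ∃ A : ℝ≥0∞, A < ∞ ∧ ∀ x : ℝ, ∑' k : ℤ, ‖(1 + |x - k|) ^ N * ξ (x - k)‖ₑ ≤ A := by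
  have hN : (0 : ℝ) ≤ N := N.cast_nonneg
  have hM0 : 0 ≤ M := (abs_nonneg _).trans (hM 0)
  obtain ⟨C, R, hC, hR, hb⟩ := h.exists_bound (by linarith)
  obtain ⟨S, hS0, hS⟩ := exists_tsum_one_add_abs_le (σ := θ - N) (by linarith)
  set D : ℝ := M * (1 + R) ^ θ + C with hD
  have hglob : ∀ y, |ξ y| ≤ D * (1 + |y|) ^ (-θ) := by
    intro y
    have h0 : 0 ≤ (1 + |y|) ^ (-θ) := by positivity
    rw [hD, add_mul]
    by_cases hy : |y| ≤ R
    · have h1 : (1 + |y|) ^ θ ≤ (1 + R) ^ θ := Real.rpow_le_rpow (by positivity) (by linarith)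
        (by linarith)
      have h2 : (1 + |y|) ^ θ * (1 + |y|) ^ (-θ) = 1 := by
        rw [← Real.rpow_add (by positivity), add_neg_cancel, Real.rpow_zero]
      have h3 : M * ((1 + |y|) ^ θ * (1 + |y|) ^ (-θ)) ≤ M * ((1 + R) ^ θ * (1 + |y|) ^ (-θ)) := by
        gcongr
      rw [h2, mul_one] at h3
      have h4 : 0 ≤ C * (1 + |y|) ^ (-θ) := by positivity
      linarith [hM y]
    · have h4 : 0 ≤ M * (1 + R) ^ θ * (1 + |y|) ^ (-θ) := by positivity
      linarith [hb y (not_le.1 hy)]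
  refine ⟨ENNReal.ofReal (D * S), ENNReal.ofReal_lt_top, fun x => ?_⟩
  calc ∑' k : ℤ, ‖(1 + |x - k|) ^ N * ξ (x - k)‖ₑ
      ≤ ∑' k : ℤ, ENNReal.ofReal (D * (1 + |x - k|) ^ (-(θ - N))) := by
        refine ENNReal.tsum_le_tsum fun k => ?_
        rw [← ofReal_norm]
        apply ENNReal.ofReal_le_ofReal
        rw [Real.norm_eq_abs, abs_mul, abs_of_nonneg (a := (1 + |x - k|) ^ N) (by positivity),
          ← one_add_abs_pow_mul_rpow]
        calc _ ≤ (1 + |x - k|) ^ N * (D * (1 + |x - k|) ^ (-θ)) := by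
              gcongr
              exact hglob _
          _ = _ := by ring
    _ = ENNReal.ofReal (∑' k : ℤ, D * (1 + |x - k|) ^ (-(θ - N))) :=
        (ENNReal.ofReal_tsum_of_nonneg (fun k => by positivity) ((hS x).1.mul_left D)).symm
    _ ≤ ENNReal.ofReal (D * S) := by
        apply ENNReal.ofReal_le_ofReal
        rw [tsum_mul_left]
        have : 0 ≤ D := by positivity
        gcongr
        exact (hS x).2

/-! ### The kernels of the Durrmeyer operators -/

/-- The last step of the chain is the fundamental theorem of calculus for absolutely continuous
functions. -/
theorem MemSobolevOne.primitiveChain {r : ℕ} {φ : ℝ → ℝ} (h : MemSobolevOne r φ) :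
    PrimitiveChain r fun i => iteratedDeriv i φ := by
  intro i hi a b
  have hder : iteratedDeriv (i + 1) φ = deriv (iteratedDeriv i φ) := iteratedDeriv_succ
  rcases Nat.lt_or_ge (i + 1) r with h1 | h1
  · have hc : Continuous (iteratedDeriv (i + 1) φ) :=
      h.contDiff.continuous_iteratedDeriv (i + 1) (by exact_mod_cast (by omega : i + 1 ≤ r - 1))
    have hd : Differentiable ℝ (iteratedDeriv i φ) :=
      h.contDiff.differentiable_iteratedDeriv i (by exact_mod_cast (by omega : i < r - 1))
    refine ⟨hc.intervalIntegrable _ _, ?_⟩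
    simp only [hder] at hc ⊢
    exact (intervalIntegral.integral_deriv_eq_sub (fun x _ => hd x)
      (hc.intervalIntegrable _ _)).symm
  · have hir : i = r - 1 := by omega
    have hac := h.absolutelyContinuous a b
    rw [← hir] at hac
    simp only [hder]
    exact ⟨hac.intervalIntegrable_deriv, hac.integral_deriv_eq_sub.symm⟩

theorem IsDiscreteKernel.exists_moment {r : ℕ} {φ : ℝ → ℝ} (hφ : IsDiscreteKernel φ)
    (hm : ConstantMoments r φ) : ∃ μ : ℕ → ℝ, ∀ ν ≤ r, ∀ u, HasDiscreteMoment φ ν u (μ ν) := by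
  have : ∀ ν : ℕ, ∃ m : ℝ, ν ≤ r → ∀ u, HasDiscreteMoment φ ν u m := by
    intro ν
    rcases Nat.eq_zero_or_pos ν with rfl | h0
    · exact ⟨1, fun _ => hφ.moment_zero⟩
    · by_cases h : ν ≤ r
      · obtain ⟨m, hm⟩ := hm ν h0 h
        exact ⟨m, fun _ => hm⟩
      · exact ⟨0, fun h' => absurd h' h⟩
  choose μ hμ using this
  exact ⟨μ, hμ⟩

/-- For `φ` itself, for which no decay is assumed, the absolute convergence of the moment series
replaces decay. -/
theorem summable_weight_of_moments {n : ℕ} {φ : ℝ → ℝ} {μ : ℕ → ℝ}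
    (hμ : ∀ ν ≤ n, ∀ u, HasDiscreteMoment φ ν u (μ ν)) (x : ℝ) :
    Summable fun k : ℤ => (1 + |(k : ℝ)|) ^ n * |φ (x - k)| := by
  have h1 : Summable fun k : ℤ => ∑ i ∈ Finset.range (n + 1),
      |φ (x - k) * ((k : ℝ) - x) ^ i| * n.choose i :=
    summable_sum fun i hi => (hμ i (by have := Finset.mem_range.1 hi; omega) x).summable.abs.mul_right _
  refine (h1.mul_left ((1 + |x|) ^ n)).of_nonneg_of_le (fun k => by positivity) fun k => ?_
  have h2 : 1 + |(k : ℝ)| ≤ (1 + |x|) * (1 + |(k : ℝ) - x|) := by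
    simpa using one_add_abs_add_le x ((k : ℝ) - x)
  have h3 : ∑ i ∈ Finset.range (n + 1), |φ (x - k) * ((k : ℝ) - x) ^ i| * n.choose i
      = (1 + |(k : ℝ) - x|) ^ n * |φ (x - k)| := by
    rw [add_comm 1, add_pow, Finset.sum_mul]
    refine Finset.sum_congr rfl fun i _ => ?_
    rw [abs_mul, abs_pow, one_pow]
    ring
  rw [h3, ← mul_assoc, ← mul_pow]
  gcongr

/-- With constant moments, the discrete kernel maps the sequence `k ^ j` to a polynomial of degree at
most `j`: expand `k ^ j` around `x`. -/
theorem exists_polynomial_of_moments {j : ℕ} {φ : ℝ → ℝ} {μ : ℕ → ℝ}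
    (hμ : ∀ ν ≤ j, ∀ u, HasDiscreteMoment φ ν u (μ ν)) {n : ℕ} (hj : j ≤ n) :
    ∃ Q : Polynomial ℝ, Q.degree < (n + 1 : ℕ) ∧
      ∀ x, synth φ (fun k => (k : ℝ) ^ j) x = Q.eval x := by
  refine ⟨∑ i ∈ Finset.range (j + 1),
    Polynomial.C (μ i * j.choose i) * Polynomial.X ^ (j - i), ?_, fun x => ?_⟩
  · rw [← Polynomial.mem_degreeLT]
    refine Submodule.sum_mem _ fun i _ => ?_
    rw [Polynomial.mem_degreeLT]
    refine (Polynomial.degree_C_mul_X_pow_le _ _).trans_lt ?_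
    exact_mod_cast (by omega : j - i < n + 1)
  · have h1 : HasSum (fun k : ℤ => ∑ i ∈ Finset.range (j + 1),
        φ (x - k) * ((k : ℝ) - x) ^ i * (x ^ (j - i) * j.choose i))
        (∑ i ∈ Finset.range (j + 1), μ i * (x ^ (j - i) * j.choose i)) :=
      hasSum_sum fun i hi =>
        HasSum.mul_right _ (hμ i (by have := Finset.mem_range.1 hi; omega) x)
    have h2 : ∀ k : ℤ, φ (x - k) * (k : ℝ) ^ j = ∑ i ∈ Finset.range (j + 1),
        φ (x - k) * ((k : ℝ) - x) ^ i * (x ^ (j - i) * j.choose i) := by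
      intro k
      conv_lhs => rw [show (k : ℝ) = (k - x) + x by ring, add_pow, Finset.mul_sum]
      refine Finset.sum_congr rfl fun i _ => ?_
      rw [sub_add_cancel]
      ring
    have h3 := (h1.congr_fun h2).tsum_eq
    rw [synth, h3, Polynomial.eval_finsetSum]
    refine Finset.sum_congr rfl fun i _ => ?_
    simp
    ring

theorem abs_le_of_absMoment_lt_top {ξ : ℝ → ℝ} (h : absMoment 0 ξ < ∞) (y : ℝ) :
    |ξ y| ≤ (absMoment 0 ξ).toReal := by
  have h1 : ‖ξ y‖ₑ ≤ absMoment 0 ξ := by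
    calc ‖ξ y‖ₑ = ‖ξ (y - (0 : ℤ))‖ₑ * ‖y - ((0 : ℤ) : ℝ)‖ₑ ^ 0 := by simp
      _ ≤ ∑' k : ℤ, ‖ξ (y - k)‖ₑ * ‖y - (k : ℝ)‖ₑ ^ 0 :=
        ENNReal.le_tsum (f := fun k : ℤ => ‖ξ (y - k)‖ₑ * ‖y - (k : ℝ)‖ₑ ^ 0) 0
      _ ≤ _ := le_iSup (fun u : ℝ => ∑' k : ℤ, ‖ξ (u - k)‖ₑ * ‖u - (k : ℝ)‖ₑ ^ 0) y
  have := ENNReal.toReal_mono h.ne h1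
  simpa using this

theorem Decay.exists_abs_le_of_continuous {θ : ℝ} (hθ : 0 ≤ θ) {ξ : ℝ → ℝ} (h : Decay θ ξ)
    (hc : Continuous ξ) : ∃ M : ℝ, ∀ y, |ξ y| ≤ M := by
  obtain ⟨C, R, hC, hR, hb⟩ := h.exists_bound hθ
  obtain ⟨M, hM⟩ := (isCompact_Icc (a := -R) (b := R)).exists_bound_of_continuousOn hc.continuousOn
  refine ⟨max M C, fun y => ?_⟩
  by_cases hy : |y| ≤ R
  · exact (hM y (abs_le.1 hy)).trans (le_max_left _ _)
  · refine ((hb y (not_le.1 hy)).trans ?_).trans (le_max_right _ _)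
    refine mul_le_of_le_one_right hC ?_
    exact Real.rpow_le_one_of_one_le_of_nonpos (by linarith [abs_nonneg y]) (by linarith)

theorem coef_congr_ae {ψ ψ' : ℝ → ℝ} (h : ψ =ᵐ[volume] ψ') (f : ℝ → ℝ) : coef ψ f = coef ψ' f := by
  ext k
  refine integral_congr_ae ?_
  filter_upwards [(measurePreserving_sub_right volume (k : ℝ)).quasiMeasurePreserving.ae h] with u hu
  rw [hu]

/-- The kernels of the theorem satisfy all requirements at every order `n + 1 ≤ r`, once `ψ` is
replaced by a Borel measurable representative. -/
theorem kernelPair_of_decay {r n : ℕ} (hn : n + 1 ≤ r) {p : ℝ≥0∞} {φ ψ ψ' : ℝ → ℝ}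
    (hφ : IsDiscreteKernel φ) (hφW : MemSobolevOne r φ) (hφm : ConstantMoments r φ)
    (hψ : Integrable ψ) (hψ' : Measurable ψ') (hae : ψ =ᵐ[volume] ψ')
    (hφd : ∀ i : ℕ, 1 ≤ i → i ≤ r → ∃ θ : ℝ, (r : ℝ) + 1 < θ ∧ Decay θ (iteratedDeriv i φ))
    (hψd : ∃ θ : ℝ, (r : ℝ) + 1 < θ ∧ Decay θ ψ)
    (hφM : 1 < p → absMoment 0 (iteratedDeriv r φ) < ∞) (hψM : p < ∞ → absMoment 0 ψ < ∞) :
    KernelPair n p (fun i => iteratedDeriv i φ) ψ' := by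
  have hchain := hφW.primitiveChain
  have hnr : ((n + 1 : ℕ) : ℝ) ≤ r := by exact_mod_cast hn
  obtain ⟨μ, hμ⟩ := hφ.exists_moment hφm
  refine ⟨?_, hchain.mono hn, ?_, ?_, ?_, ?_, hψ', ?_, ?_⟩
  · intro i
    cases i with
    | zero => exact (hchain.continuous (by omega : 0 < r)).measurable
    | succ i =>
      simp only [iteratedDeriv_succ]
      exact measurable_deriv _
  · intro i hi x
    rcases Nat.eq_zero_or_pos i with rfl | h0
    · simp only [iteratedDeriv_zero]
      exact summable_weight_of_moments (fun ν hν => hμ ν (by omega)) x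
    · obtain ⟨θ, hθ, hd⟩ := hφd i h0 (hi.trans hn)
      refine hd.summable_weight ?_ x
      push_cast at hnr
      linarith
  · intro i hi
    obtain ⟨θ, hθ, hd⟩ := hφd (i + 1) (by omega) (by omega)
    exact hd.integrable_weight (by linarith) (hchain.locallyIntegrable (by omega))
  · by_cases hp : 1 < p
    · obtain ⟨θ, hθ, hd⟩ := hφd (n + 1) (by omega) hn
      have hθ0 : 0 ≤ θ := by
        have : (0 : ℝ) ≤ r := r.cast_nonneg
        linarith
      have hM : ∃ M : ℝ, ∀ y, |iteratedDeriv (n + 1) φ y| ≤ M := by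
        rcases hn.eq_or_lt with h | h
        · rw [h]
          exact ⟨_, abs_le_of_absMoment_lt_top (hφM hp)⟩
        · exact hd.exists_abs_le_of_continuous hθ0 (hchain.continuous h)
      obtain ⟨M, hM⟩ := hM
      obtain ⟨A, hA, hA'⟩ := hd.exists_tsum_weight_le (N := n + 1) (by linarith) hM
      exact ⟨A, fun _ => hA, hA'⟩
    · exact ⟨∞, fun h => absurd h hp, fun x => le_top⟩
  · intro j hj
    simp only [iteratedDeriv_zero]
    exact exists_polynomial_of_moments (fun ν hν => hμ ν (by omega)) hj
  · obtain ⟨θ, hθ, hd⟩ := hψd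
    refine (hd.integrable_weight (N := n + 1) (by linarith) hψ.locallyIntegrable).congr ?_
    filter_upwards [hae] with u hu
    rw [hu]
  · by_cases hp : p < ∞
    · refine ⟨absMoment 0 ψ, hψM, ?_⟩
      have hk : ∀ᵐ u : ℝ, ∀ k : ℤ, ψ (u - k) = ψ' (u - k) := ae_all_iff.2 fun k =>
        (measurePreserving_sub_right volume (k : ℝ)).quasiMeasurePreserving.ae hae
      filter_upwards [hk] with u hu
      calc ∑' k : ℤ, ‖ψ' (u - k)‖ₑ = ∑' k : ℤ, ‖ψ (u - k)‖ₑ * ‖u - (k : ℝ)‖ₑ ^ 0 := by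
            simp [hu]
        _ ≤ _ := le_iSup (fun u : ℝ => ∑' k : ℤ, ‖ψ (u - k)‖ₑ * ‖u - (k : ℝ)‖ₑ ^ 0) u
    · exact ⟨∞, fun h => absurd h hp, ae_of_all _ fun x => le_top⟩

theorem MemSpace.memLp {p : ℝ≥0∞} {f : ℝ → ℝ} (hf : MemSpace p f) : MemLp f p volume := by
  unfold MemSpace at hf
  split_ifs at hf with hp
  · obtain ⟨hc, B, hB⟩ := hf
    rw [hp]
    exact memLp_top_of_bound hc.continuous.aestronglyMeasurable B (ae_of_all _ hB)
  · exact hf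

theorem eLpNorm_le_pNorm (p : ℝ≥0∞) (g : ℝ → ℝ) : eLpNorm g p volume ≤ pNorm p g := by
  unfold pNorm
  split_ifs with hp
  · rw [hp, eLpNorm_exponent_top]
    exact eLpNormEssSup_le_of_ae_enorm_bound
      (ae_of_all _ fun x => le_iSup (fun x => ‖g x‖ₑ) x)
  · exact le_rfl

theorem pNorm_le_eLpNorm_of_continuous {g : ℝ → ℝ} (hg : Continuous g) :
    pNorm ∞ g ≤ eLpNorm g ∞ volume := by
  rw [pNorm, if_pos rfl, eLpNorm_exponent_top]
  refine iSup_le fun x => ?_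
  have hd : Dense {x | ‖g x‖ₑ ≤ eLpNormEssSup g volume} :=
    Measure.dense_of_ae ae_le_eLpNormEssSup
  have hcl : IsClosed {x | ‖g x‖ₑ ≤ eLpNormEssSup g volume} :=
    isClosed_le hg.enorm continuous_const
  have : x ∈ closure {x | ‖g x‖ₑ ≤ eLpNormEssSup g volume} := hd x
  rwa [hcl.closure_eq] at this

/-- For `f` in the space denoted `L^p`, the norm of a finite difference is the Lebesgue norm, also
for `p = ∞`. -/
theorem pNorm_diff_le {p : ℝ≥0∞} {f : ℝ → ℝ} (hf : MemSpace p f) (m : ℕ) (t : ℝ) :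
    pNorm p (diff m t f) ≤ eLpNorm (diff m t f) p volume := by
  rcases eq_or_ne p ∞ with rfl | hp
  · rw [MemSpace, if_pos rfl] at hf
    have hc := hf.1.continuous
    refine pNorm_le_eLpNorm_of_continuous ?_
    unfold diff
    fun_prop
  · rw [pNorm, if_neg hp]

theorem memLipStar_of_rate {r : ℕ} {φ ψ f : ℝ → ℝ} {p : ℝ≥0∞} (hp : 1 ≤ p) {α : ℝ}
    (hα0 : 0 < α) (hαr : α < r) (hφ : IsDiscreteKernel φ) (hφW : MemSobolevOne r φ)
    (hφm : ConstantMoments r φ) (hψ : IsContinuousKernel ψ) (hf : MemSpace p f)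
    (hrate : ∃ C : ℝ, ∀ᶠ w : ℝ in atTop,
      pNorm p (fun x => op φ ψ w f x - f x) ≤ ENNReal.ofReal (C * w ^ (-α)))
    (hφd : ∀ i : ℕ, 1 ≤ i → i ≤ r → ∃ θ : ℝ, (r : ℝ) + 1 < θ ∧ Decay θ (iteratedDeriv i φ))
    (hψd : ∃ θ : ℝ, (r : ℝ) + 1 < θ ∧ Decay θ ψ)
    (hφM : 1 < p → absMoment 0 (iteratedDeriv r φ) < ∞) (hψM : p < ∞ → absMoment 0 ψ < ∞) :
    MemLipStar α p f := by
  have hn : ⌊α⌋₊ + 1 ≤ r := by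
    have := (Nat.floor_lt hα0.le).2 hαr
    omega
  set ψ' := hψ.integrable.1.mk ψ with hψ'
  have hae : ψ =ᵐ[volume] ψ' := hψ.integrable.1.ae_eq_mk
  have H := kernelPair_of_decay hn hφ hφW hφm hψ.integrable
    hψ.integrable.1.stronglyMeasurable_mk.measurable hae hφd hψd hφM hψM
  obtain ⟨C, hC⟩ := hrate
  obtain ⟨N, hN⟩ := H.inverse hp hα0 (Nat.lt_floor_add_one α) hf.memLp ⟨C, by
    filter_upwards [hC, eventually_gt_atTop 0] with w hw hw0
    refine le_trans (le_of_eq ?_) ((eLpNorm_le_pNorm p _).trans hw)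
    congr 1
    ext x
    rw [op_eq_synth _ _ _ hw0, op_eq_synth _ _ _ hw0, coef_congr_ae hae, iteratedDeriv_zero]⟩
  refine ⟨hf, N, ?_⟩
  filter_upwards [hN] with δ hδ
  exact iSup₂_le fun t ht => (pNorm_diff_le hf _ t).trans (hδ t ht)

end Durrmeyer

theorem mainTheorem2 (r : ℕ) (hr : 1 < r) (φ ψ f : ℝ → ℝ) (p : ℝ≥0∞) (hp : 1 ≤ p) (α : ℝ)
    (hα0 : 0 < α) (hαr : α < r)
    (hφ : Durrmeyer.IsDiscreteKernel φ) (hφW : Durrmeyer.MemSobolevOne r φ)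
    (hφm : Durrmeyer.ConstantMoments r φ)
    (hψ : Durrmeyer.IsContinuousKernel ψ)
    (hf : Durrmeyer.MemSpace p f)
    (hrate : ∃ C : ℝ, ∀ᶠ w : ℝ in atTop,
      Durrmeyer.pNorm p (fun x => Durrmeyer.op φ ψ w f x - f x) ≤ ENNReal.ofReal (C * w ^ (-α))) :
    (p = ∞ →
      (∀ i : ℕ, 1 ≤ i → i ≤ r → ∃ θ : ℝ, (r : ℝ) + 1 < θ ∧ Durrmeyer.Decay θ (iteratedDeriv i φ)) →
      (∃ θ : ℝ, (r : ℝ) + 1 < θ ∧ Durrmeyer.Decay θ ψ) →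
      Durrmeyer.absMoment 0 (iteratedDeriv r φ) < ∞ →
      Durrmeyer.MemLipStar α ∞ f) ∧
    (p < ∞ →
      (∀ i : ℕ, 1 ≤ i → i ≤ r →
        ∃ θ : ℝ, p.toReal * r + 1 < θ ∧ Durrmeyer.Decay θ (iteratedDeriv i φ)) →
      (∃ θ : ℝ, p.toReal * r + 1 < θ ∧ Durrmeyer.Decay θ ψ) →
      (p = 1 → HasCompactSupport ψ) →
      Durrmeyer.absMoment 0 ψ < ∞ →
      (1 < p → Durrmeyer.absMoment 0 (iteratedDeriv r φ) < ∞) →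
      Durrmeyer.MemLipStar α p f) := by
  refine ⟨?_, ?_⟩
  · rintro rfl hφd hψd hφM
    exact Durrmeyer.memLipStar_of_rate hp hα0 hαr hφ hφW hφm hψ hf hrate hφd hψd (fun _ => hφM)
      fun h => absurd h (lt_irrefl _)
  · intro hp' hφd hψd _ hψM hφM
    have h1 := Durrmeyer.one_le_toReal hp hp'.ne
    have h2 : (r : ℝ) ≤ p.toReal * r := le_mul_of_one_le_left r.cast_nonneg h1
    refine Durrmeyer.memLipStar_of_rate hp hα0 hαr hφ hφW hφm hψ hf hrate ?_ ?_ hφM fun _ => hψM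
    · intro i hi hir
      obtain ⟨θ, hθ, hd⟩ := hφd i hi hir
      exact ⟨θ, by linarith, hd⟩
    · obtain ⟨θ, hθ, hd⟩ := hψd
      exact ⟨θ, by linarith, hd⟩
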